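/- Consider the first-in-first-out $G/G/1$ queue: the interarrival times are i.i.d. copies of $U\ge 0$, the service times are i.i.d. copies of $S\ge 0$, and the two sequences are independent. Assume that $\mathbb{E}U^3<\infty$, $\mathbb{E}S^3<\infty$, $\mathbb{E}S>0$, and that $U$ is nonlattice (for no $d>0$ is $U$ concentrated on the integer multiples of $d$). Put $\lambda=1/\mathbb{E}U$, $\rho=\lambda\,\mathbb{E}S$, and assume $\rho<1$. Let a customer arrive to an empty system at time $0$, let $V(t)$ be the workload (remaining work) at time $t\ge 0$, and let $X$ have the limiting steady-state distribution of the scaled workload, that is, $(1-\rho)V(t)\to X$ in distribution as $t\to\infty$. Let $\bar I$ be the duration of the idle period that follows the busy period started by an arrival to an empty system. Let $Y$ be exponentially distributed with rate $2/(\lambda\,\mathbb{E}(S-\rho U)^2)$, where $S$ and $U$ are independent. Then $\mathbb{E}|X|<\infty$, $\mathbb{E}\bar I^2<\infty$, $\mathbb{E}\bar I>0$, and \[ \sup_{h\in \mathrm{Lip}(1)}\bigl|\mathbb{E}h(X)-\mathbb{E}h(Y)\bigr|\le (1-\rho)\left((2+\rho)\frac{\mathbb{E}U^2}{2\,\mathbb{E}U}+\rho\,\frac{\mathbb{E}\bar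 I^2}{2\,\mathbb{E}\bar I}+2\,\mathbb{E}S+4\,\frac{\mathbb{E}|S-\rho U|^3}{\mathbb{E}(S-\rho U)^2}\right), \] where $\mathrm{Lip}(1)$ is the set of functions $h:\mathbb{R}\to\mathbb{R}$ with Lipschitz constant at most $1$. -/

import Mathlib

open MeasureTheory ProbabilityTheory Filter Topology

noncomputable section

namespace GG1

variable {Ω : Type*}

/-- The interarrival times `U 0, U 1, …` and the service times `S 0, S 1, …` of a `G/G/1` queue:
two independent sequences of i.i.d. nonnegative random variables. Customer `0` arrives at time `0`,
`U n` is the time between the arrivals of the customers `n` and `n + 1`, and `S n` is the service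
time of customer `n`. -/
structure IsInput [MeasurableSpace Ω] (P : Measure Ω) (U S : ℕ → Ω → ℝ) : Prop where
  measurable_interarrival : ∀ n, Measurable (U n)
  measurable_service : ∀ n, Measurable (S n)
  nonneg_interarrival : ∀ n, ∀ᵐ ω ∂P, 0 ≤ U n ω
  nonneg_service : ∀ n, ∀ᵐ ω ∂P, 0 ≤ S n ω
  identDistrib_interarrival : ∀ n, IdentDistrib (U n) (U 0) P P
  identDistrib_service : ∀ n, IdentDistrib (S n) (S 0) P P
  indep : iIndepFun (fun i : ℕ ⊕ ℕ => Sum.elim U S i) P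

/-- A random variable is nonlattice if, for every `d > 0`, it is not concentrated on the integer
multiples of `d`. -/
def Nonlattice [MeasurableSpace Ω] (P : Measure Ω) (T : Ω → ℝ) : Prop :=
  ∀ d : ℝ, 0 < d → ¬ ∀ᵐ ω ∂P, ∃ k : ℤ, T ω = k * d

/-- The arrival rate `λ = 1 / 𝔼 U`. -/
def arrivalRate [MeasurableSpace Ω] (P : Measure Ω) (U : ℕ → Ω → ℝ) : ℝ :=
  1 / ∫ ω, U 0 ω ∂P

/-- The utilization `ρ = λ 𝔼 S`. -/
def utilization [MeasurableSpace Ω] (P : Measure Ω) (U S : ℕ → Ω → ℝ) : ℝ :=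
  arrivalRate P U * ∫ ω, S 0 ω ∂P

/-- The arrival time of customer `n`. -/
def arrivalTime (U : ℕ → Ω → ℝ) (n : ℕ) (ω : Ω) : ℝ :=
  ∑ k ∈ Finset.range n, U k ω

/-- The index of the last customer that arrived in `[0, t]`, for `t ≥ 0`. -/
def lastArrival (U : ℕ → Ω → ℝ) (t : ℝ) (ω : Ω) : ℕ :=
  sSup {n : ℕ | arrivalTime U n ω ≤ t}

/-- The workload found by customer `n`, the arrival of this customer excluded; customer `0` finds
an empty system. -/
def workloadBefore (U S : ℕ → Ω → ℝ) : ℕ → Ω → ℝ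
  | 0, _ => 0
  | n + 1, ω => max (workloadBefore U S n ω + S n ω - U n ω) 0

/-- The workload `V(t)` at time `t ≥ 0` when customer `0` arrives to an empty system at time `0`:
it jumps by `S n` at the arrival of customer `n` and decreases at unit rate while positive. -/
def workload (U S : ℕ → Ω → ℝ) (t : ℝ) (ω : Ω) : ℝ :=
  max (workloadBefore U S (lastArrival U t ω) ω + S (lastArrival U t ω) ω
    - (t - arrivalTime U (lastArrival U t ω) ω)) 0

/-- The residual time `R(t)`: the time from `t ≥ 0` until the next arrival. -/
def residual (U : ℕ → Ω → ℝ) (t : ℝ) (ω : Ω) : ℝ :=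
  arrivalTime U (lastArrival U t ω + 1) ω - t

/-- The duration of the busy period that starts when customer `0` arrives to an empty system at
time `0`: the first time at which the workload is zero. -/
def busyPeriod (U S : ℕ → Ω → ℝ) (ω : Ω) : ℝ :=
  sInf {t : ℝ | 0 ≤ t ∧ workload U S t ω = 0}

/-- The duration of the idle period that follows this busy period: the time from the end of the
busy period until the next arrival. -/
def idlePeriod (U S : ℕ → Ω → ℝ) (ω : Ω) : ℝ :=
  residual U (busyPeriod U S ω) ω

/-- The scaled workload `X(t) = (1 - ρ) V(t)`. -/
def scaledWorkload [MeasurableSpace Ω] (P : Measure Ω) (U S : ℕ → Ω → ℝ) (t : ℝ) (ω : Ω) : ℝ :=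
  (1 - utilization P U S) * workload U S t ω

/-- The steady state of the scaled workload: `X`, defined on a probability space of its own, has
the limiting distribution of `X(t)` as `t → ∞`. -/
def IsSteadyState [MeasurableSpace Ω] (P : Measure Ω) [IsProbabilityMeasure P] (U S : ℕ → Ω → ℝ)
    {Ω' : Type*} [MeasurableSpace Ω'] (P' : Measure Ω') [IsProbabilityMeasure P']
    (X : Ω' → ℝ) : Prop :=
  TendstoInDistribution (fun t : ℝ => scaledWorkload P U S t) atTop X (fun _ => P) P'

end GG1

end

/-! ### Independence from the past, the Lindley recursion, and the mean idle time per customer -/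

noncomputable section

namespace GG1

variable {Ω : Type*}

/-! The proof is Stein's method for the exponential law, with the generator comparison made along
the queue between arrivals. Let `r` be the rate of `Y`, `δ = 1 - ρ`, and let `q` be the bounded
solution of `q' / r - q = h - 𝔼 h(Y)`. It satisfies `q 0 = 0`, is 1-Lipschitz, and has a
`2r`-Lipschitz derivative. Put `G v = q (δ v)`, `F = ∫ G`, `D = G'`. Then `r⁻¹ D - δ G` at workload
`v` equals `δ (h (δ v) - 𝔼 h(Y))`, so the error to be bounded is the limiting mean of this diffusion
generator along the workload.

Let `W` be the workload found by a customer. From one arrival to the next, `F(W)` changes in two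
stages. Adding `S - ρ U` to `W` is a mean-zero step independent of `W`, so a second-order Taylor
expansion leaves only the diffusion term and a cubic error. Moving from `W + S - ρ U` to `max (W + S
- U) 0` produces the integral of `-δ G` along the path, with errors quadratic in `U` and in the idle
time; `G 0 = 0` removes the reflection term. This is `abs_integral_cycle_generator_le`.

Summing over `n` cycles and dividing by `n`, three limits are needed (`abs_limit_generator_le`). The
telescoped term vanishes because `𝔼 W_n = O(√n)`. Cycle averages become `𝔼 U` times the time limit,
since by the L¹ law of large numbers `n` cycles occupy `[0, n 𝔼 U]` up to `o(n)`
(`tendsto_sum_integral_cycle`). The averages of squared idle times are controlled by a renewal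
equation for restarts at an empty system (`lintegral_idleTime`): its first-moment version identifies
the frequency of restarts as `(𝔼 U - 𝔼 S) / 𝔼 Ī`, and its second-moment version then gives a bound
by `𝔼 Ī²` times this frequency (`exists_tendsto_sum_sq_idleTime_le`).

This settles bounded `h`, for which convergence in distribution suffices. Truncations of `|x|` then
give `𝔼 |X| < ∞`, and truncations of `h` give the general case. -/

/-- The σ-algebra generated by the interarrival and service times of the customers before `k`. -/
abbrev past (U S : ℕ → Ω → ℝ) (k : ℕ) : MeasurableSpace Ω :=
  ⨆ i ∈ {i : ℕ ⊕ ℕ | i.elim id id < k}, MeasurableSpace.comap (Sum.elim U S i) inferInstance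

lemma past_mono (U S : ℕ → Ω → ℝ) {j k : ℕ} (h : j ≤ k) : past U S j ≤ past U S k :=
  biSup_mono fun _ hi => lt_of_lt_of_le hi h

lemma measurable_past_interarrival (U S : ℕ → Ω → ℝ) {j k : ℕ} (h : j < k) :
    Measurable[past U S k] (U j) := by
  apply measurable_iff_comap_le.2
  exact le_iSup₂_of_le (f := fun (i : ℕ ⊕ ℕ) (_ : i ∈ {i : ℕ ⊕ ℕ | i.elim id id < k}) =>
    MeasurableSpace.comap (Sum.elim U S i) inferInstance) (Sum.inl j) h le_rfl

lemma measurable_past_service (U S : ℕ → Ω → ℝ) {j k : ℕ} (h : j < k) :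
    Measurable[past U S k] (S j) := by
  apply measurable_iff_comap_le.2
  exact le_iSup₂_of_le (f := fun (i : ℕ ⊕ ℕ) (_ : i ∈ {i : ℕ ⊕ ℕ | i.elim id id < k}) =>
    MeasurableSpace.comap (Sum.elim U S i) inferInstance) (Sum.inr j) h le_rfl

lemma measurable_past_workloadBefore (U S : ℕ → Ω → ℝ) (k : ℕ) :
    Measurable[past U S k] (workloadBefore U S k) := by
  induction k with
  | zero => exact measurable_const
  | succ k ih =>
    have h1 := ih.mono (past_mono U S k.le_succ) le_rfl
    exact ((h1.add (measurable_past_service U S k.lt_succ_self)).sub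
      (measurable_past_interarrival U S k.lt_succ_self)).max measurable_const

lemma workloadBefore_nonneg (U S : ℕ → Ω → ℝ) (k : ℕ) (ω : Ω) : 0 ≤ workloadBefore U S k ω := by
  cases k with
  | zero => exact le_rfl
  | succ k => exact le_max_right _ _

/-- The idle time between the arrivals of the customers `k` and `k + 1`. -/
def idleTime (U S : ℕ → Ω → ℝ) (k : ℕ) (ω : Ω) : ℝ :=
  max (U k ω - (workloadBefore U S k ω + S k ω)) 0

lemma idleTime_nonneg (U S : ℕ → Ω → ℝ) (k : ℕ) (ω : Ω) : 0 ≤ idleTime U S k ω := le_max_right _ _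

lemma workloadBefore_succ (U S : ℕ → Ω → ℝ) (k : ℕ) (ω : Ω) :
    workloadBefore U S (k + 1) ω
      = workloadBefore U S k ω + S k ω - U k ω + idleTime U S k ω := by
  simp only [workloadBefore, idleTime]
  rcases le_total (workloadBefore U S k ω + S k ω - U k ω) 0 with h | h
  · rw [max_eq_right h, max_eq_left (by linarith)]; ring
  · rw [max_eq_left h, max_eq_right (by linarith)]; ring

variable [MeasurableSpace Ω] {P : Measure Ω} {U S : ℕ → Ω → ℝ}

namespace IsInput

lemma past_le (h : IsInput P U S) (k : ℕ) : past U S k ≤ ‹MeasurableSpace Ω› := by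
  refine iSup₂_le fun i _ => ?_
  rcases i with i | i
  · exact (h.measurable_interarrival i).comap_le
  · exact (h.measurable_service i).comap_le

lemma measurable_workloadBefore (h : IsInput P U S) (k : ℕ) : Measurable (workloadBefore U S k) :=
  (measurable_past_workloadBefore U S k).mono (h.past_le k) le_rfl

lemma measurable_idleTime (h : IsInput P U S) (k : ℕ) : Measurable (idleTime U S k) :=
  ((h.measurable_interarrival k).sub
    ((h.measurable_workloadBefore k).add (h.measurable_service k))).max measurable_const

lemma measurable_pair (h : IsInput P U S) (k : ℕ) : Measurable fun ω => (U k ω, S k ω) :=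
  (h.measurable_interarrival k).prodMk (h.measurable_service k)

lemma indepFun_past (h : IsInput P U S) {β : Type*} [MeasurableSpace β] {k : ℕ} {Z : Ω → β}
    (hZ : Measurable[past U S k] Z) : IndepFun Z (fun ω => (U k ω, S k ω)) P := by
  have hle : ∀ i : ℕ ⊕ ℕ, MeasurableSpace.comap (Sum.elim U S i) inferInstance
      ≤ ‹MeasurableSpace Ω› := by
    rintro (i | i)
    · exact (h.measurable_interarrival i).comap_le
    · exact (h.measurable_service i).comap_le
  have hd : Disjoint {i : ℕ ⊕ ℕ | i.elim id id < k} {Sum.inl k, Sum.inr k} := by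
    rw [Set.disjoint_left]
    rintro i hi (rfl | rfl) <;> simp at hi
  have key := indep_iSup_of_disjoint hle h.indep hd
  rw [IndepFun_iff_Indep]
  refine indep_of_indep_of_le_left (indep_of_indep_of_le_right key ?_) hZ.comap_le
  apply measurable_iff_comap_le.1
  refine Measurable.prodMk ?_ ?_ <;> apply measurable_iff_comap_le.2
  · exact le_iSup₂_of_le (f := fun (i : ℕ ⊕ ℕ) (_ : i ∈ ({Sum.inl k, Sum.inr k} : Set (ℕ ⊕ ℕ))) =>
      MeasurableSpace.comap (Sum.elim U S i) inferInstance) (Sum.inl k) (by simp) le_rfl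
  · exact le_iSup₂_of_le (f := fun (i : ℕ ⊕ ℕ) (_ : i ∈ ({Sum.inl k, Sum.inr k} : Set (ℕ ⊕ ℕ))) =>
      MeasurableSpace.comap (Sum.elim U S i) inferInstance) (Sum.inr k) (by simp) le_rfl

lemma indepFun_interarrival_service (h : IsInput P U S) (k : ℕ) : IndepFun (U k) (S k) P :=
  h.indep.indepFun (i := Sum.inl k) (j := Sum.inr k) (by simp)

lemma memLp_interarrival (h : IsInput P U S) {p : ENNReal} (hU : MemLp (U 0) p P) (k : ℕ) :
    MemLp (U k) p P :=
  (h.identDistrib_interarrival k).memLp_iff.2 hU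

lemma memLp_service (h : IsInput P U S) {p : ENNReal} (hS : MemLp (S 0) p P) (k : ℕ) :
    MemLp (S k) p P :=
  (h.identDistrib_service k).memLp_iff.2 hS

variable [IsProbabilityMeasure P]

lemma identDistrib_pair (h : IsInput P U S) (k : ℕ) :
    IdentDistrib (fun ω => (U k ω, S k ω)) (fun ω => (U 0 ω, S 0 ω)) P P where
  aemeasurable_fst := (h.measurable_pair k).aemeasurable
  aemeasurable_snd := (h.measurable_pair 0).aemeasurable
  map_eq := by
    rw [(h.indepFun_interarrival_service k).map_prod_eq_prod_map_map
      (h.measurable_interarrival k).aemeasurable (h.measurable_service k).aemeasurable,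
      (h.indepFun_interarrival_service 0).map_prod_eq_prod_map_map
      (h.measurable_interarrival 0).aemeasurable (h.measurable_service 0).aemeasurable,
      (h.identDistrib_interarrival k).map_eq, (h.identDistrib_service k).map_eq]

/-- Fubini for the product law of `Z` and the current pair: with the past frozen, the pair may be
replaced by an independent copy of the pair of customer `0`. All Markov-type arguments below rest on
this. -/
lemma lintegral_past (h : IsInput P U S) {β : Type*} [MeasurableSpace β] {k : ℕ} {Z : Ω → β}
    (hZ : Measurable[past U S k] Z) {Φ : β × (ℝ × ℝ) → ENNReal} (hΦ : Measurable Φ) :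
    ∫⁻ ω, Φ (Z ω, (U k ω, S k ω)) ∂P = ∫⁻ ω, ∫⁻ ω', Φ (Z ω, (U 0 ω', S 0 ω')) ∂P ∂P := by
  have hZ' : Measurable Z := hZ.mono (h.past_le k) le_rfl
  have h1 := (h.indepFun_past hZ).map_prod_eq_prod_map_map hZ'.aemeasurable
    (h.measurable_pair k).aemeasurable
  rw [(h.identDistrib_pair k).map_eq] at h1
  rw [← lintegral_map hΦ (hZ'.prodMk (h.measurable_pair k)), h1, lintegral_prod _ hΦ.aemeasurable,
    lintegral_map (hΦ.lintegral_prod_right') hZ']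
  refine lintegral_congr fun ω => ?_
  exact lintegral_map (hΦ.comp measurable_prodMk_left) (h.measurable_pair 0)

lemma integrable_past_mul (h : IsInput P U S) {k : ℕ} {Z : Ω → ℝ}
    (hZ : Measurable[past U S k] Z) (hZi : Integrable Z P) {φ : ℝ × ℝ → ℝ} (hφ : Measurable φ)
    (hφi : Integrable (fun ω => φ (U 0 ω, S 0 ω)) P) :
    Integrable (fun ω => Z ω * φ (U k ω, S k ω)) P := by
  have h1 : Integrable (fun ω => φ (U k ω, S k ω)) P :=
    ((h.identDistrib_pair k).comp hφ).integrable_iff.2 hφi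
  exact ((h.indepFun_past hZ).comp measurable_id hφ).integrable_mul hZi h1

lemma integral_pair (h : IsInput P U S) (k : ℕ) {φ : ℝ × ℝ → ℝ} (hφ : Measurable φ) :
    ∫ ω, φ (U k ω, S k ω) ∂P = ∫ ω, φ (U 0 ω, S 0 ω) ∂P :=
  ((h.identDistrib_pair k).comp hφ).integral_eq

lemma integrable_pair (h : IsInput P U S) (k : ℕ) {φ : ℝ × ℝ → ℝ} (hφ : Measurable φ)
    (hi : Integrable (fun ω => φ (U 0 ω, S 0 ω)) P) : Integrable (fun ω => φ (U k ω, S k ω)) P :=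
  ((h.identDistrib_pair k).comp hφ).integrable_iff.2 hi

lemma integral_past_mul (h : IsInput P U S) {k : ℕ} {Z : Ω → ℝ}
    (hZ : Measurable[past U S k] Z) {φ : ℝ × ℝ → ℝ} (hφ : Measurable φ) :
    ∫ ω, Z ω * φ (U k ω, S k ω) ∂P = (∫ ω, Z ω ∂P) * ∫ ω, φ (U 0 ω, S 0 ω) ∂P := by
  rw [← h.integral_pair k hφ]
  exact ((h.indepFun_past hZ).comp measurable_id hφ).integral_fun_mul_eq_mul_integral
    (hZ.mono (h.past_le k) le_rfl).aestronglyMeasurable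
    (hφ.comp (h.measurable_pair k)).aestronglyMeasurable

lemma memLp_workloadBefore (h : IsInput P U S) {p : ENNReal} (hU : MemLp (U 0) p P)
    (hS : MemLp (S 0) p P) (k : ℕ) : MemLp (workloadBefore U S k) p P := by
  induction k with
  | zero => exact MemLp.zero
  | succ k ih =>
    have h1 := (ih.add (h.memLp_service hS k)).sub (h.memLp_interarrival hU k)
    refine h1.mono (h.measurable_workloadBefore (k + 1)).aestronglyMeasurable (ae_of_all _ ?_)
    intro ω
    simp only [workloadBefore, Real.norm_eq_abs, Pi.add_apply, Pi.sub_apply]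
    rw [abs_of_nonneg (le_max_right _ _)]
    exact max_le (le_abs_self _) (abs_nonneg _)

lemma memLp_idleTime (h : IsInput P U S) {p : ENNReal} (hU : MemLp (U 0) p P)
    (hS : MemLp (S 0) p P) (k : ℕ) : MemLp (idleTime U S k) p P := by
  have h1 := (h.memLp_interarrival hU k).sub ((h.memLp_workloadBefore hU hS k).add
    (h.memLp_service hS k))
  refine h1.mono (h.measurable_idleTime k).aestronglyMeasurable (ae_of_all _ ?_)
  intro ω
  simp only [idleTime, Real.norm_eq_abs, Pi.add_apply, Pi.sub_apply]
  rw [abs_of_nonneg (le_max_right _ _)]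
  exact max_le (le_abs_self _) (abs_nonneg _)

/-- Since `max x 0 ^ 2 ≤ x ^ 2`, squaring the recursion leaves a cross term whose mean is `2 𝔼 W_n
(𝔼 S - 𝔼 U) ≤ 0`; each step therefore adds at most `𝔼 (S - U)²`. -/
lemma integral_sq_workloadBefore_le (h : IsInput P U S) (hU : MemLp (U 0) 2 P)
    (hS : MemLp (S 0) 2 P) (hdrift : ∫ ω, S 0 ω ∂P ≤ ∫ ω, U 0 ω ∂P) (n : ℕ) :
    ∫ ω, workloadBefore U S n ω ^ 2 ∂P ≤ n * ∫ ω, (S 0 ω - U 0 ω) ^ 2 ∂P := by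
  have hU1 := hU.integrable (by norm_num)
  have hS1 := hS.integrable (by norm_num)
  induction n with
  | zero => simp [workloadBefore]
  | succ n ih =>
    have hW := h.memLp_workloadBefore hU hS n
    have hW1 := hW.integrable (by norm_num)
    have hm : Measurable (fun p : ℝ × ℝ => p.2 - p.1) := by fun_prop
    have hm2 : Measurable (fun p : ℝ × ℝ => (p.2 - p.1) ^ 2) := by fun_prop
    have i1 : Integrable (fun ω => workloadBefore U S n ω * (S n ω - U n ω)) P :=
      h.integrable_past_mul (measurable_past_workloadBefore U S n) hW1 hm (hS1.sub hU1)
    have e1 := h.integral_past_mul (measurable_past_workloadBefore U S n) hm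
    have i2 : Integrable (fun ω => (S n ω - U n ω) ^ 2) P :=
      ((h.memLp_service hS n).sub (h.memLp_interarrival hU n)).integrable_sq
    have e2 := h.integral_pair n hm2
    have i3 := hW.integrable_sq
    have hle : ∫ ω, workloadBefore U S (n + 1) ω ^ 2 ∂P ≤
        ∫ ω, (workloadBefore U S n ω ^ 2 + 2 * (workloadBefore U S n ω * (S n ω - U n ω))
          + (S n ω - U n ω) ^ 2) ∂P := by
      refine integral_mono (h.memLp_workloadBefore hU hS (n + 1)).integrable_sq
        ((i3.add (i1.const_mul 2)).add i2) fun ω => ?_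
      simp only [workloadBefore]
      rcases le_total (workloadBefore U S n ω + S n ω - U n ω) 0 with hx | hx
      · rw [max_eq_right hx]
        nlinarith [sq_nonneg (workloadBefore U S n ω + S n ω - U n ω)]
      · rw [max_eq_left hx]; apply le_of_eq; ring
    have i4 : Integrable (fun ω => 2 * (workloadBefore U S n ω * (S n ω - U n ω))) P :=
      i1.const_mul 2
    have i5 : Integrable (fun ω => workloadBefore U S n ω ^ 2
        + 2 * (workloadBefore U S n ω * (S n ω - U n ω))) P := i3.add i4
    rw [integral_add i5 i2, integral_add i3 i4, integral_const_mul] at hle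
    simp only at e1 e2
    rw [e1, e2, integral_sub hS1 hU1] at hle
    have hWn : 0 ≤ ∫ ω, workloadBefore U S n ω ∂P :=
      integral_nonneg (workloadBefore_nonneg U S n)
    push_cast
    nlinarith

lemma tendsto_integral_workloadBefore_div (h : IsInput P U S) (hU : MemLp (U 0) 2 P)
    (hS : MemLp (S 0) 2 P) (hdrift : ∫ ω, S 0 ω ∂P ≤ ∫ ω, U 0 ω ∂P) :
    Tendsto (fun n : ℕ => (n : ℝ)⁻¹ * ∫ ω, workloadBefore U S n ω ∂P) atTop (𝓝 0) := by
  set C := ∫ ω, (S 0 ω - U 0 ω) ^ 2 ∂P with hC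
  have hC0 : 0 ≤ C := integral_nonneg fun ω => sq_nonneg _
  have hlim : Tendsto (fun n : ℕ => Real.sqrt ((n : ℝ)⁻¹ * C)) atTop (𝓝 0) := by
    have := (tendsto_inv_atTop_nhds_zero_nat (𝕜 := ℝ)).mul_const C
    rw [zero_mul] at this
    simpa using this.sqrt
  refine squeeze_zero' (Eventually.of_forall fun n => ?_) ?_ hlim
  · have : 0 ≤ ∫ ω, workloadBefore U S n ω ∂P := integral_nonneg (workloadBefore_nonneg U S n)
    positivity
  · filter_upwards [eventually_gt_atTop 0] with n hn
    have hn' : (0 : ℝ) < n := by exact_mod_cast hn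
    apply Real.le_sqrt_of_sq_le
    have hW := h.memLp_workloadBefore hU hS n
    have h1 := h.integral_sq_workloadBefore_le hU hS hdrift n
    have h2 : (∫ ω, workloadBefore U S n ω ∂P) ^ 2 ≤ ∫ ω, workloadBefore U S n ω ^ 2 ∂P := by
      have := variance_nonneg (workloadBefore U S n) P
      rw [variance_eq_sub hW] at this
      simpa using this
    rw [mul_pow]
    calc (n : ℝ)⁻¹ ^ 2 * (∫ ω, workloadBefore U S n ω ∂P) ^ 2 ≤ (n : ℝ)⁻¹ ^ 2 * (n * C) := by
          gcongr; exact h2.trans h1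
      _ = (n : ℝ)⁻¹ * C := by field_simp

/-- The means of `W_{k+1} = W_k + S_k - U_k + I_k` telescope. With `𝔼 W_n = o(n)` this makes `𝔼 U -
𝔼 S` the mean idle time per customer. -/
lemma sum_integral_idleTime (h : IsInput P U S) (hU : MemLp (U 0) 2 P)
    (hS : MemLp (S 0) 2 P) (n : ℕ) :
    ∑ k ∈ Finset.range n, ∫ ω, idleTime U S k ω ∂P
      = ∫ ω, workloadBefore U S n ω ∂P + n * (∫ ω, U 0 ω ∂P - ∫ ω, S 0 ω ∂P) := by
  induction n with
  | zero => simp [workloadBefore]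
  | succ n ih =>
    have hW := (h.memLp_workloadBefore hU hS n).integrable (by norm_num)
    have hI := (h.memLp_idleTime hU hS n).integrable (by norm_num)
    have hUn := (h.memLp_interarrival hU n).integrable (by norm_num)
    have hSn := (h.memLp_service hS n).integrable (by norm_num)
    have e : ∫ ω, workloadBefore U S (n + 1) ω ∂P = ∫ ω, workloadBefore U S n ω ∂P
        + ∫ ω, S 0 ω ∂P - ∫ ω, U 0 ω ∂P + ∫ ω, idleTime U S n ω ∂P := by
      simp_rw [workloadBefore_succ]
      have i1 : Integrable (fun ω => workloadBefore U S n ω + S n ω) P := hW.add hSn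
      have i2 : Integrable (fun ω => workloadBefore U S n ω + S n ω - U n ω) P := i1.sub hUn
      rw [integral_add i2 hI, integral_sub i1 hUn, integral_add hW hSn, (h.identDistrib_interarrival n).integral_eq,
        (h.identDistrib_service n).integral_eq]
    rw [Finset.sum_range_succ, ih, e]
    push_cast
    ring

lemma tendsto_sum_integral_idleTime (h : IsInput P U S) (hU : MemLp (U 0) 2 P)
    (hS : MemLp (S 0) 2 P) (hdrift : ∫ ω, S 0 ω ∂P ≤ ∫ ω, U 0 ω ∂P) :
    Tendsto (fun n : ℕ => (n : ℝ)⁻¹ * ∑ k ∈ Finset.range n, ∫ ω, idleTime U S k ω ∂P) atTop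
      (𝓝 (∫ ω, U 0 ω ∂P - ∫ ω, S 0 ω ∂P)) := by
  have h1 := (h.tendsto_integral_workloadBefore_div hU hS hdrift).add_const
    (∫ ω, U 0 ω ∂P - ∫ ω, S 0 ω ∂P)
  rw [zero_add] at h1
  refine h1.congr' ?_
  filter_upwards [eventually_gt_atTop 0] with n hn
  have hn' : (n : ℝ) ≠ 0 := by positivity
  rw [h.sum_integral_idleTime hU hS]
  field_simp

end IsInput

end GG1

end

/-! ### The first busy period: finite mean number of customers, moments of the idle period -/

noncomputable section

namespace GG1

variable {Ω : Type*}

section Pathwise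

variable {U S : ℕ → Ω → ℝ} {ω : Ω}

lemma arrivalTime_succ (U : ℕ → Ω → ℝ) (n : ℕ) (ω : Ω) :
    arrivalTime U (n + 1) ω = arrivalTime U n ω + U n ω := by
  simp [arrivalTime, Finset.sum_range_succ]

lemma arrivalTime_mono (hU : ∀ n, 0 ≤ U n ω) : Monotone fun n => arrivalTime U n ω :=
  monotone_nat_of_le_succ fun n => by
    simp only [arrivalTime_succ]; linarith [hU n]

lemma lastArrival_eq (hU : ∀ n, 0 ≤ U n ω) {k : ℕ} {t : ℝ} (h1 : arrivalTime U k ω ≤ t)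
    (h2 : t < arrivalTime U (k + 1) ω) : lastArrival U t ω = k := by
  have hset : {n : ℕ | arrivalTime U n ω ≤ t} = Set.Iic k := by
    ext n
    simp only [Set.mem_ofPred_eq, Set.mem_Iic]
    constructor
    · intro hn
      by_contra! hk
      have := arrivalTime_mono hU (Nat.succ_le_of_lt hk)
      simp only [Nat.succ_eq_add_one] at this
      linarith
    · intro hn
      exact (arrivalTime_mono hU hn).trans h1
  rw [lastArrival, hset, csSup_Iic]

lemma workload_eq (hU : ∀ n, 0 ≤ U n ω) {k : ℕ} {t : ℝ} (h1 : arrivalTime U k ω ≤ t)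
    (h2 : t < arrivalTime U (k + 1) ω) :
    workload U S t ω = max (workloadBefore U S k ω + S k ω - (t - arrivalTime U k ω)) 0 := by
  rw [workload, lastArrival_eq hU h1 h2]

lemma exists_arrivalTime_le_lt {n : ℕ} {t : ℝ} (h0 : 0 ≤ t) (ht : t < arrivalTime U n ω) :
    ∃ j < n, arrivalTime U j ω ≤ t ∧ t < arrivalTime U (j + 1) ω := by
  induction n with
  | zero => simp [arrivalTime] at ht; linarith
  | succ n ih =>
    rcases lt_or_ge t (arrivalTime U n ω) with h | h
    · obtain ⟨j, hj, h'⟩ := ih h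
      exact ⟨j, by omega, h'⟩
    · exact ⟨n, by omega, h, ht⟩

/-- The weak inequality before `K` is the right one: formulas for the workload hold on half-open
intervals `[T_j, T_{j+1})`, so when work runs out exactly at an arrival the next service time is
already counted. The workload first vanishes at `T_K + W_K + S_K`. -/
lemma idlePeriod_eq (hU : ∀ n, 0 ≤ U n ω) (hS : ∀ n, 0 ≤ S n ω) {K : ℕ}
    (hK : ∀ j < K, 0 ≤ workloadBefore U S j ω + S j ω - U j ω)
    (hlt : workloadBefore U S K ω + S K ω - U K ω < 0) :
    idlePeriod U S ω = idleTime U S K ω := by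
  set t₀ := arrivalTime U K ω + (workloadBefore U S K ω + S K ω) with ht₀
  have hW := workloadBefore_nonneg U S K ω
  have hT0 : 0 ≤ arrivalTime U K ω := by
    simpa [arrivalTime] using arrivalTime_mono hU (Nat.zero_le K)
  have h1 : arrivalTime U K ω ≤ t₀ := by linarith [hS K]
  have h2 : t₀ < arrivalTime U (K + 1) ω := by rw [arrivalTime_succ]; linarith
  have hleast : IsLeast {t : ℝ | 0 ≤ t ∧ workload U S t ω = 0} t₀ := by
    refine ⟨⟨by linarith, ?_⟩, ?_⟩
    · rw [workload_eq hU h1 h2, max_eq_right]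
      linarith
    · rintro t ⟨ht, hw⟩
      by_contra! hlt'
      obtain ⟨j, hj, hj1, hj2⟩ := exists_arrivalTime_le_lt (U := U) ht (hlt'.trans h2)
      rw [workload_eq hU hj1 hj2] at hw
      have hw' := le_max_left (workloadBefore U S j ω + S j ω - (t - arrivalTime U j ω)) 0
      rw [hw] at hw'
      rcases Nat.lt_succ_iff_lt_or_eq.1 hj with hjK | rfl
      · have := hK j hjK
        rw [arrivalTime_succ] at hj2
        linarith
      · linarith
  rw [idlePeriod, busyPeriod, hleast.csInf_eq, residual, lastArrival_eq hU h1 h2, idleTime,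
    max_eq_left (by linarith), arrivalTime_succ]
  ring

/-- The indicator that no idle time occurs before the arrival of customer `k`. -/
def busyIndicator (U S : ℕ → Ω → ℝ) : ℕ → Ω → ℝ
  | 0, _ => 1
  | k + 1, ω => if 0 ≤ workloadBefore U S k ω + S k ω - U k ω then busyIndicator U S k ω else 0

lemma busyIndicator_eq_zero_or_one (U S : ℕ → Ω → ℝ) (k : ℕ) (ω : Ω) :
    busyIndicator U S k ω = 0 ∨ busyIndicator U S k ω = 1 := by
  induction k with
  | zero => exact Or.inr rfl
  | succ k ih =>
    simp only [busyIndicator]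
    split_ifs
    · exact ih
    · exact Or.inl rfl

lemma busyIndicator_nonneg (U S : ℕ → Ω → ℝ) (k : ℕ) (ω : Ω) : 0 ≤ busyIndicator U S k ω := by
  rcases busyIndicator_eq_zero_or_one U S k ω with h | h <;> simp [h]

lemma busyIndicator_le_one (U S : ℕ → Ω → ℝ) (k : ℕ) (ω : Ω) : busyIndicator U S k ω ≤ 1 := by
  rcases busyIndicator_eq_zero_or_one U S k ω with h | h <;> simp [h]

lemma busyIndicator_eq_one {K : ℕ}
    (hK : ∀ j < K, 0 ≤ workloadBefore U S j ω + S j ω - U j ω) : busyIndicator U S K ω = 1 := by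
  induction K with
  | zero => rfl
  | succ k ih =>
    rw [busyIndicator, if_pos (hK k k.lt_succ_self), ih fun j hj => hK j (by omega)]

lemma busyIndicator_eq_zero {K k : ℕ} (hKk : K < k)
    (hK : workloadBefore U S K ω + S K ω - U K ω < 0) : busyIndicator U S k ω = 0 := by
  induction k, hKk using Nat.le_induction with
  | base => simp [busyIndicator, not_le.2 hK]
  | succ k hk ih => simp [busyIndicator, ih]

lemma idleTime_eq_zero {k : ℕ} (h : 0 ≤ workloadBefore U S k ω + S k ω - U k ω) :
    idleTime U S k ω = 0 := max_eq_right (by linarith)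

lemma exists_first_idle (h : ∃ k, busyIndicator U S k ω = 0) :
    ∃ K, (∀ j < K, 0 ≤ workloadBefore U S j ω + S j ω - U j ω) ∧
      workloadBefore U S K ω + S K ω - U K ω < 0 := by
  classical
  have hex : ∃ k, workloadBefore U S k ω + S k ω - U k ω < 0 := by
    by_contra! hne
    obtain ⟨k, hk⟩ := h
    rw [busyIndicator_eq_one fun j _ => hne j] at hk
    exact one_ne_zero hk
  exact ⟨Nat.find hex, fun j hj => not_lt.1 (Nat.find_min hex hj), Nat.find_spec hex⟩

/-- Only the term `K` survives: earlier idle times are `0` and `r 0 = 0`, later indicators are `0`.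
-/
lemma hasSum_busyIndicator_mul {K : ℕ}
    (hK : ∀ j < K, 0 ≤ workloadBefore U S j ω + S j ω - U j ω)
    (hlt : workloadBefore U S K ω + S K ω - U K ω < 0) {r : ℝ → ℝ} (hr : r 0 = 0) :
    HasSum (fun k => busyIndicator U S k ω * r (idleTime U S k ω)) (r (idleTime U S K ω)) := by
  have := hasSum_single (f := fun k => busyIndicator U S k ω * r (idleTime U S k ω)) K ?_
  · simpa [busyIndicator_eq_one hK] using this
  · intro k hk
    rcases lt_or_gt_of_ne hk with h | h
    · simp [idleTime_eq_zero (hK k h), hr]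
    · simp [busyIndicator_eq_zero h hlt]

lemma measurable_past_busyIndicator (U S : ℕ → Ω → ℝ) (k : ℕ) :
    Measurable[past U S k] (busyIndicator U S k) := by
  induction k with
  | zero => exact measurable_const
  | succ k ih =>
    have h0 := (measurable_past_workloadBefore U S k).mono (past_mono U S k.le_succ) le_rfl
    have h1 := ih.mono (past_mono U S k.le_succ) le_rfl
    have h2 := (h0.add (measurable_past_service U S k.lt_succ_self)).sub
      (measurable_past_interarrival U S k.lt_succ_self)
    exact Measurable.ite (h2 measurableSet_Ici) h1 measurable_const

end Pathwise

variable [MeasurableSpace Ω] {P : Measure Ω} {U S : ℕ → Ω → ℝ}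

namespace IsInput

lemma measurable_busyIndicator (h : IsInput P U S) (k : ℕ) : Measurable (busyIndicator U S k) :=
  (measurable_past_busyIndicator U S k).mono (h.past_le k) le_rfl

variable [IsProbabilityMeasure P]

lemma integrable_busyIndicator (h : IsInput P U S) (k : ℕ) :
    Integrable (busyIndicator U S k) P := by
  refine Integrable.of_bound (h.measurable_busyIndicator k).aestronglyMeasurable 1
    (ae_of_all _ fun ω => ?_)
  rw [Real.norm_eq_abs, abs_of_nonneg (busyIndicator_nonneg U S k ω)]
  exact busyIndicator_le_one U S k ω

lemma integrable_busyIndicator_mul (h : IsInput P U S) (k : ℕ) {f : Ω → ℝ} (hf : Integrable f P) :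
    Integrable (fun ω => busyIndicator U S k ω * f ω) P := by
  refine hf.mono ((h.measurable_busyIndicator k).aestronglyMeasurable.mul hf.1)
    (ae_of_all _ fun ω => ?_)
  rw [norm_mul, Real.norm_eq_abs, abs_of_nonneg (busyIndicator_nonneg U S k ω)]
  exact mul_le_of_le_one_left (norm_nonneg _) (busyIndicator_le_one U S k ω)

lemma integral_busyIndicator_nonneg (k : ℕ) : 0 ≤ ∫ ω, busyIndicator U S k ω ∂P :=
  integral_nonneg (busyIndicator_nonneg U S k)

/-- With `B` the indicator, `B_{k+1} W_{k+1} = B_k (W_k + S_k - U_k + I_k)` in both cases: if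
idleness occurs, the bracket is `0`. As `B_k` depends on the past only, its product with `S_k - U_k`
has a factorized mean. -/
lemma integral_busyIndicator_mul_workloadBefore (h : IsInput P U S) (hU : MemLp (U 0) 2 P)
    (hS : MemLp (S 0) 2 P) (n : ℕ) :
    ∫ ω, busyIndicator U S n ω * workloadBefore U S n ω ∂P
      = (∫ ω, S 0 ω ∂P - ∫ ω, U 0 ω ∂P) * ∑ k ∈ Finset.range n, ∫ ω, busyIndicator U S k ω ∂P
        + ∑ k ∈ Finset.range n, ∫ ω, busyIndicator U S k ω * idleTime U S k ω ∂P := by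
  induction n with
  | zero => simp [workloadBefore]
  | succ n ih =>
    have hW := (h.memLp_workloadBefore hU hS n).integrable (by norm_num)
    have hI := (h.memLp_idleTime hU hS n).integrable (by norm_num)
    have hUn := (h.memLp_interarrival hU n).integrable (by norm_num)
    have hSn := (h.memLp_service hS n).integrable (by norm_num)
    have hm : Measurable (fun p : ℝ × ℝ => p.2 - p.1) := by fun_prop
    have e1 := h.integral_past_mul (measurable_past_busyIndicator U S n) hm
    simp only at e1
    rw [integral_sub ((h.memLp_service hS 0).integrable (by norm_num))
      ((h.memLp_interarrival hU 0).integrable (by norm_num))] at e1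
    have e2 : ∀ ω, busyIndicator U S (n + 1) ω * workloadBefore U S (n + 1) ω
        = busyIndicator U S n ω * workloadBefore U S n ω
          + busyIndicator U S n ω * (S n ω - U n ω)
          + busyIndicator U S n ω * idleTime U S n ω := by
      intro ω
      by_cases hx : 0 ≤ workloadBefore U S n ω + S n ω - U n ω
      · rw [workloadBefore_succ]
        simp only [busyIndicator, if_pos hx]
        ring
      · have hx' := not_le.1 hx
        simp only [busyIndicator, if_neg hx, idleTime]
        rw [max_eq_left (by linarith)]
        ring
    simp_rw [e2]
    have i1 := h.integrable_busyIndicator_mul n hW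
    have i2 : Integrable (fun ω => busyIndicator U S n ω * (S n ω - U n ω)) P :=
      h.integrable_busyIndicator_mul n (hSn.sub hUn)
    have i3 := h.integrable_busyIndicator_mul n hI
    have i4 : Integrable (fun ω => busyIndicator U S n ω * workloadBefore U S n ω
          + busyIndicator U S n ω * (S n ω - U n ω)) P := i1.add i2
    rw [integral_add i4 i3, integral_add i1 i2, ih, e1, Finset.sum_range_succ,
      Finset.sum_range_succ]
    ring

/-- The idle time is nonzero only in the step where the indicator drops, and there it is at most
`U_k ≤ c + U_k² / (4c)`. The `c` part telescopes, and the rest factorizes by independence. The free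
parameter `c` lets the second part be absorbed by the drift. -/
lemma sum_integral_busyIndicator_le (h : IsInput P U S) (hU : MemLp (U 0) 2 P)
    (hS : MemLp (S 0) 2 P) {c : ℝ} (hc : 0 < c) (n : ℕ) :
    ∑ k ∈ Finset.range n, ∫ ω, busyIndicator U S k ω * idleTime U S k ω ∂P
      ≤ c + (∫ ω, U 0 ω ^ 2 ∂P) / (4 * c) *
        ∑ k ∈ Finset.range n, ∫ ω, busyIndicator U S k ω ∂P := by
  have hstep : ∀ k, ∫ ω, busyIndicator U S k ω * idleTime U S k ω ∂P
      ≤ c * (∫ ω, busyIndicator U S k ω ∂P - ∫ ω, busyIndicator U S (k + 1) ω ∂P)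
        + (∫ ω, U 0 ω ^ 2 ∂P) / (4 * c) * ∫ ω, busyIndicator U S k ω ∂P := by
    intro k
    have hm : Measurable (fun p : ℝ × ℝ => p.1 ^ 2) := by fun_prop
    have e1 := h.integral_past_mul (measurable_past_busyIndicator U S k) hm
    simp only at e1
    have hI := (h.memLp_idleTime hU hS k).integrable (by norm_num)
    have i1 := h.integrable_busyIndicator_mul k (h.memLp_interarrival hU k).integrable_sq
    have i2 : Integrable (fun ω => c * (busyIndicator U S k ω - busyIndicator U S (k + 1) ω)) P :=
      ((h.integrable_busyIndicator k).sub (h.integrable_busyIndicator (k + 1))).const_mul c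
    calc ∫ ω, busyIndicator U S k ω * idleTime U S k ω ∂P
        ≤ ∫ ω, (c * (busyIndicator U S k ω - busyIndicator U S (k + 1) ω)
          + (busyIndicator U S k ω * U k ω ^ 2) / (4 * c)) ∂P := by
          refine integral_mono_ae (h.integrable_busyIndicator_mul k hI)
            (i2.add (i1.div_const _)) ?_
          filter_upwards [h.nonneg_service k] with ω hs
          have hW := workloadBefore_nonneg U S k ω
          by_cases hx : 0 ≤ workloadBefore U S k ω + S k ω - U k ω
          · simp only [idleTime_eq_zero hx, busyIndicator, if_pos hx, mul_zero, sub_self, zero_add]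
            have := busyIndicator_nonneg U S k ω
            positivity
          · have hx' := not_le.1 hx
            have hle : idleTime U S k ω ≤ c + U k ω ^ 2 / (4 * c) := by
              rw [idleTime, max_eq_left (by linarith)]
              have : U k ω ≤ c + U k ω ^ 2 / (4 * c) := by
                rw [← sub_le_iff_le_add', le_div_iff₀ (by positivity)]
                nlinarith [sq_nonneg (U k ω - 2 * c)]
              linarith
            simp only [busyIndicator, if_neg hx, sub_zero]
            have := mul_le_mul_of_nonneg_left hle (busyIndicator_nonneg U S k ω)
            calc _ ≤ _ := this
              _ = _ := by ring
      _ = _ := by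
          rw [integral_add i2 (i1.div_const _), integral_const_mul, integral_div, e1,
            integral_sub (h.integrable_busyIndicator k) (h.integrable_busyIndicator (k + 1))]
          ring
  calc _ ≤ ∑ k ∈ Finset.range n,
        (c * (∫ ω, busyIndicator U S k ω ∂P - ∫ ω, busyIndicator U S (k + 1) ω ∂P)
        + (∫ ω, U 0 ω ^ 2 ∂P) / (4 * c) * ∫ ω, busyIndicator U S k ω ∂P) :=
        Finset.sum_le_sum fun k _ => hstep k
    _ = c * (∫ ω, busyIndicator U S 0 ω ∂P - ∫ ω, busyIndicator U S n ω ∂P)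
        + (∫ ω, U 0 ω ^ 2 ∂P) / (4 * c) *
        ∑ k ∈ Finset.range n, ∫ ω, busyIndicator U S k ω ∂P := by
        rw [Finset.sum_add_distrib, ← Finset.mul_sum, ← Finset.mul_sum,
          Finset.sum_range_sub' (fun k => ∫ ω, busyIndicator U S k ω ∂P)]
    _ ≤ _ := by
        have h1 : ∫ ω, busyIndicator U S 0 ω ∂P = 1 := by simp [busyIndicator]
        have h2 : 0 ≤ ∫ ω, busyIndicator U S n ω ∂P := integral_busyIndicator_nonneg n
        rw [h1]
        nlinarith

/-- The busy period serves finitely many customers in the mean when the drift is negative. -/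
lemma summable_integral_busyIndicator (h : IsInput P U S) (hU : MemLp (U 0) 2 P)
    (hS : MemLp (S 0) 2 P) (hdrift : ∫ ω, S 0 ω ∂P < ∫ ω, U 0 ω ∂P) :
    Summable fun k => ∫ ω, busyIndicator U S k ω ∂P := by
  set D := ∫ ω, U 0 ω ∂P - ∫ ω, S 0 ω ∂P with hD
  have hD0 : 0 < D := by linarith
  set Q := ∫ ω, U 0 ω ^ 2 ∂P with hQ
  have hQ0 : 0 ≤ Q := integral_nonneg fun ω => sq_nonneg _
  -- Chosen so that `Q / (4c) ≤ D / 2`, hence half of the drift term remains after absorption; `Q +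
  -- 1` instead of `Q` makes `c > 0` immediate.
  set c := (Q + 1) / (2 * D) with hc
  have hc0 : 0 < c := by positivity
  have hQc : Q / (4 * c) ≤ D / 2 := by
    rw [div_le_iff₀ (by positivity), hc]
    field_simp
    linarith
  refine summable_of_sum_range_le (c := 2 * c / D) (fun k => integral_busyIndicator_nonneg k)
    fun n => ?_
  have h1 := h.integral_busyIndicator_mul_workloadBefore hU hS n
  have h2 : 0 ≤ ∫ ω, busyIndicator U S n ω * workloadBefore U S n ω ∂P :=
    integral_nonneg fun ω => mul_nonneg (busyIndicator_nonneg U S n ω)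
      (workloadBefore_nonneg U S n ω)
  have h3 := h.sum_integral_busyIndicator_le hU hS hc0 n
  have h4 : 0 ≤ ∑ k ∈ Finset.range n, ∫ ω, busyIndicator U S k ω ∂P :=
    Finset.sum_nonneg fun k _ => integral_busyIndicator_nonneg k
  have h5 := mul_le_mul_of_nonneg_right hQc h4
  rw [le_div_iff₀ hD0]
  nlinarith

lemma ae_exists_first_idle (h : IsInput P U S) (hU : MemLp (U 0) 2 P)
    (hS : MemLp (S 0) 2 P) (hdrift : ∫ ω, S 0 ω ∂P < ∫ ω, U 0 ω ∂P) :
    ∀ᵐ ω ∂P, ∃ K, (∀ j < K, 0 ≤ workloadBefore U S j ω + S j ω - U j ω) ∧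
      workloadBefore U S K ω + S K ω - U K ω < 0 := by
  have hsum := h.summable_integral_busyIndicator hU hS hdrift
  have h1 : ∫⁻ ω, ∑' k, ENNReal.ofReal (busyIndicator U S k ω) ∂P ≠ ⊤ := by
    rw [lintegral_tsum fun k => (h.measurable_busyIndicator k).ennreal_ofReal.aemeasurable]
    have : ∀ k, ∫⁻ ω, ENNReal.ofReal (busyIndicator U S k ω) ∂P
        = ENNReal.ofReal (∫ ω, busyIndicator U S k ω ∂P) := fun k =>
      (ofReal_integral_eq_lintegral_ofReal (h.integrable_busyIndicator k)
        (ae_of_all _ (busyIndicator_nonneg U S k))).symm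
    simp_rw [this]
    exact hsum.tsum_ofReal_ne_top
  have h2 := ae_lt_top (Measurable.tsum fun k =>
    (h.measurable_busyIndicator k).ennreal_ofReal) h1
  filter_upwards [h2] with ω hω
  apply exists_first_idle
  by_contra! hne
  have : ∀ k, ENNReal.ofReal (busyIndicator U S k ω) = 1 := fun k => by
    rw [(busyIndicator_eq_zero_or_one U S k ω).resolve_left (hne k), ENNReal.ofReal_one]
  simp_rw [this, ENNReal.tsum_const_eq_top_of_ne_zero one_ne_zero] at hω
  exact lt_irrefl _ hω

lemma ae_hasSum_idlePeriod (h : IsInput P U S) (hU : MemLp (U 0) 2 P)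
    (hS : MemLp (S 0) 2 P) (hdrift : ∫ ω, S 0 ω ∂P < ∫ ω, U 0 ω ∂P) {r : ℝ → ℝ} (hr : r 0 = 0) :
    ∀ᵐ ω ∂P, HasSum (fun k => busyIndicator U S k ω * r (idleTime U S k ω))
      (r (idlePeriod U S ω)) := by
  filter_upwards [h.ae_exists_first_idle hU hS hdrift, ae_all_iff.2 h.nonneg_interarrival,
    ae_all_iff.2 h.nonneg_service] with ω ⟨K, hK, hlt⟩ hu hs
  rw [idlePeriod_eq hu hs hK hlt]
  exact hasSum_busyIndicator_mul hK hlt hr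

lemma ae_idlePeriod_pos (h : IsInput P U S) (hU : MemLp (U 0) 2 P)
    (hS : MemLp (S 0) 2 P) (hdrift : ∫ ω, S 0 ω ∂P < ∫ ω, U 0 ω ∂P) :
    ∀ᵐ ω ∂P, 0 < idlePeriod U S ω := by
  filter_upwards [h.ae_exists_first_idle hU hS hdrift, ae_all_iff.2 h.nonneg_interarrival,
    ae_all_iff.2 h.nonneg_service] with ω ⟨K, hK, hlt⟩ hu hs
  rw [idlePeriod_eq hu hs hK hlt]
  exact lt_max_of_lt_left (by linarith)

/-- The moments of the idle period, decomposed by the last customer of the busy period. -/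
lemma hasSum_integral_idlePeriod (h : IsInput P U S) (hU : MemLp (U 0) 2 P)
    (hS : MemLp (S 0) 2 P) (hdrift : ∫ ω, S 0 ω ∂P < ∫ ω, U 0 ω ∂P) {p : ℕ} (hp : p ≠ 0)
    (hp2 : p ≤ 2) :
    Integrable (fun ω => idlePeriod U S ω ^ p) P ∧
    HasSum (fun k => ∫ ω, busyIndicator U S k ω * idleTime U S k ω ^ p ∂P)
      (∫ ω, idlePeriod U S ω ^ p ∂P) := by
  have hLp : ∀ {f : Ω → ℝ}, MemLp f 2 P → Integrable (fun ω => f ω ^ p) P := by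
    intro f hf
    interval_cases p
    · exact absurd rfl hp
    · simpa using hf.integrable (by norm_num)
    · exact hf.integrable_sq
  have hi : ∀ k, Integrable (fun ω => busyIndicator U S k ω * idleTime U S k ω ^ p) P := fun k =>
    h.integrable_busyIndicator_mul k (hLp (h.memLp_idleTime hU hS k))
  have hn : ∀ k ω, 0 ≤ busyIndicator U S k ω * idleTime U S k ω ^ p := fun k ω =>
    mul_nonneg (busyIndicator_nonneg U S k ω) (pow_nonneg (idleTime_nonneg U S k ω) p)
  have hm : Measurable (fun q : ℝ × ℝ => q.1 ^ p) := by fun_prop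
  -- Domination by `I_k ≤ U_k`, where `U_k` is independent of the indicator, reduces summability to
  -- that of the indicators.
  have hle : ∀ k, ∫ ω, busyIndicator U S k ω * idleTime U S k ω ^ p ∂P
      ≤ (∫ ω, U 0 ω ^ p ∂P) * ∫ ω, busyIndicator U S k ω ∂P := by
    intro k
    have e1 := h.integral_past_mul (measurable_past_busyIndicator U S k) hm
    simp only at e1
    rw [mul_comm, ← e1]
    refine integral_mono_ae (hi k)
      (h.integrable_busyIndicator_mul k (hLp (h.memLp_interarrival hU k))) ?_
    filter_upwards [h.nonneg_service k, h.nonneg_interarrival k] with ω hs hu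
    refine mul_le_mul_of_nonneg_left ?_ (busyIndicator_nonneg U S k ω)
    refine pow_le_pow_left₀ (idleTime_nonneg U S k ω) ?_ p
    exact max_le (by linarith [workloadBefore_nonneg U S k ω]) hu
  have hsum : Summable fun k => ∫ ω, busyIndicator U S k ω * idleTime U S k ω ^ p ∂P :=
    Summable.of_nonneg_of_le (fun k => integral_nonneg (hn k)) hle
      ((h.summable_integral_busyIndicator hU hS hdrift).mul_left _)
  have hsum' : Summable fun k => ∫ ω, ‖busyIndicator U S k ω * idleTime U S k ω ^ p‖ ∂P := by
    simpa only [Real.norm_eq_abs, abs_of_nonneg (hn _ _)] using hsum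
  have hae := h.ae_hasSum_idlePeriod hU hS hdrift (r := fun x => x ^ p) (by simp [hp])
  have hcongr : (fun ω => ∑' k, busyIndicator U S k ω * idleTime U S k ω ^ p) =ᵐ[P]
      fun ω => idlePeriod U S ω ^ p := by
    filter_upwards [hae] with ω hω using hω.tsum_eq
  constructor
  · have hmeas : ∀ k, Measurable fun ω =>
        ENNReal.ofReal (busyIndicator U S k ω * idleTime U S k ω ^ p) := fun k =>
      ((h.measurable_busyIndicator k).mul ((h.measurable_idleTime k).pow_const p)).ennreal_ofReal
    have hfin : ∫⁻ ω, ∑' k, ENNReal.ofReal (busyIndicator U S k ω * idleTime U S k ω ^ p) ∂P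
        ≠ ⊤ := by
      rw [lintegral_tsum fun k => (hmeas k).aemeasurable]
      simp_rw [fun k => (ofReal_integral_eq_lintegral_ofReal (hi k) (ae_of_all _ (hn k))).symm]
      exact hsum.tsum_ofReal_ne_top
    refine (integrable_toReal_of_lintegral_ne_top (Measurable.tsum hmeas).aemeasurable hfin).congr
      ?_
    filter_upwards [hae] with ω hω
    rw [← ENNReal.ofReal_tsum_of_nonneg (fun k => hn k ω) hω.summable, hω.tsum_eq,
      ENNReal.toReal_ofReal (hω.nonneg fun k => hn k ω)]
  · rw [← integral_congr_ae hcongr]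
    exact hasSum_integral_of_summable_integral_norm hi hsum'

end IsInput

end GG1

end

/-! ### The renewal equation of the idle times and the average squared idle time -/

noncomputable section

namespace GG1

variable {Ω : Type*} [MeasurableSpace Ω] {P : Measure Ω} {U S : ℕ → Ω → ℝ}

/-- The expected reward `r` of the next idle time, if it is the one after `m` more customers, for a
queue whose next customer finds the workload `w`. -/
def idleReward (P : Measure Ω) (U S : ℕ → Ω → ℝ) (r : ℝ → ENNReal) : ℕ → ℝ → ENNReal
  | 0, w => ∫⁻ ω, r (max (U 0 ω - (w + S 0 ω)) 0) ∂P
  | m + 1, w => ∫⁻ ω, if 0 ≤ w + S 0 ω - U 0 ω then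
      idleReward P U S r m (w + S 0 ω - U 0 ω) else 0 ∂P

/-- The probability that customer `k` is the first one, or arrives at the end of an idle time. -/
def busyStart (P : Measure Ω) (U S : ℕ → Ω → ℝ) : ℕ → ENNReal
  | 0 => 1
  | k + 1 => P {ω | workloadBefore U S k ω + S k ω - U k ω < 0}

namespace IsInput

variable [IsProbabilityMeasure P]

lemma measurable_idleReward (h : IsInput P U S) {r : ℝ → ENNReal} (hr : Measurable r) (m : ℕ) :
    Measurable (idleReward P U S r m) := by
  have h0 := h.measurable_interarrival 0
  have h1 := h.measurable_service 0
  induction m with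
  | zero =>
    refine Measurable.lintegral_prod_right' (f := fun q : ℝ × Ω =>
      r (max (U 0 q.2 - (q.1 + S 0 q.2)) 0)) ?_
    exact hr.comp (by fun_prop)
  | succ m ih =>
    refine Measurable.lintegral_prod_right' (f := fun q : ℝ × Ω =>
      if 0 ≤ q.1 + S 0 q.2 - U 0 q.2 then
      idleReward P U S r m (q.1 + S 0 q.2 - U 0 q.2) else 0) ?_
    have hm : Measurable fun q : ℝ × Ω => q.1 + S 0 q.2 - U 0 q.2 := by fun_prop
    exact Measurable.ite (hm measurableSet_Ici) (ih.comp hm) measurable_const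

/-- The Markov property: conditioning on the past of customer `k` trades one factor of the indicator
at `k + 1` for one more step in the reward function. Working in `ENNReal` spares all integrability
conditions. -/
lemma lintegral_busyIndicator_mul_idleReward (h : IsInput P U S) {r : ℝ → ENNReal}
    (hr : Measurable r) (m k : ℕ) :
    ∫⁻ ω, ENNReal.ofReal (busyIndicator U S k ω) * idleReward P U S r m (workloadBefore U S k ω) ∂P
      = idleReward P U S r (m + k) 0 := by
  induction k generalizing m with
  | zero => simp [busyIndicator, workloadBefore]
  | succ k ih =>
    rw [show m + (k + 1) = (m + 1) + k by ring, ← ih]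
    have hZ := (measurable_past_busyIndicator U S k).prodMk (measurable_past_workloadBefore U S k)
    have hm := h.measurable_idleReward hr m
    have hΦ : Measurable fun q : (ℝ × ℝ) × (ℝ × ℝ) => ENNReal.ofReal q.1.1 *
        if 0 ≤ q.1.2 + q.2.2 - q.2.1 then idleReward P U S r m (q.1.2 + q.2.2 - q.2.1) else 0 := by
      refine Measurable.mul (by fun_prop) (Measurable.ite ?_ (hm.comp (by fun_prop))
        measurable_const)
      exact measurableSet_le measurable_const (by fun_prop)
    have key := h.lintegral_past hZ hΦ
    simp only at key
    have e : ∀ ω, ENNReal.ofReal (busyIndicator U S (k + 1) ω)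
        * idleReward P U S r m (workloadBefore U S (k + 1) ω)
        = ENNReal.ofReal (busyIndicator U S k ω) *
          if 0 ≤ workloadBefore U S k ω + S k ω - U k ω then
            idleReward P U S r m (workloadBefore U S k ω + S k ω - U k ω) else 0 := by
      intro ω
      by_cases hx : 0 ≤ workloadBefore U S k ω + S k ω - U k ω
      · simp [busyIndicator, workloadBefore, hx]
      · simp [busyIndicator, hx]
    simp_rw [e]
    rw [key]
    refine lintegral_congr fun ω => ?_
    rw [lintegral_const_mul' _ _ ENNReal.ofReal_ne_top]
    rfl

lemma lintegral_mul_idleTime (h : IsInput P U S) {r : ℝ → ENNReal} (hr : Measurable r) {k : ℕ}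
    {Z : Ω → ENNReal} (hZ : Measurable[past U S k] Z) (hZt : ∀ ω, Z ω ≠ ⊤) :
    ∫⁻ ω, Z ω * r (idleTime U S k ω) ∂P
      = ∫⁻ ω, Z ω * idleReward P U S r 0 (workloadBefore U S k ω) ∂P := by
  have hΦ : Measurable fun q : (ENNReal × ℝ) × (ℝ × ℝ) => q.1.1 *
      r (max (q.2.1 - (q.1.2 + q.2.2)) 0) :=
    Measurable.mul (by fun_prop) (hr.comp (by fun_prop))
  have key := h.lintegral_past (hZ.prodMk (measurable_past_workloadBefore U S k)) hΦ
  simp only at key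
  simp only [idleTime]
  rw [key]
  refine lintegral_congr fun ω => ?_
  rw [lintegral_const_mul' _ _ (hZt ω)]
  rfl

lemma lintegral_busyIndicator_mul_idleTime (h : IsInput P U S) {r : ℝ → ENNReal}
    (hr : Measurable r) (k : ℕ) :
    ∫⁻ ω, ENNReal.ofReal (busyIndicator U S k ω) * r (idleTime U S k ω) ∂P
      = idleReward P U S r k 0 := by
  rw [h.lintegral_mul_idleTime hr (measurable_past_busyIndicator U S k).ennreal_ofReal
    fun ω => ENNReal.ofReal_ne_top, h.lintegral_busyIndicator_mul_idleReward hr, zero_add]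

/-- Decomposition by the last restart `j ≤ k`. From `k` to `k + 1`, either no idleness occurs and
the horizon `m` grows by one at customer `k`, or the workload restarts from `0`, which gives the new
summand `j = k + 1`. -/
lemma lintegral_idleReward (h : IsInput P U S) {r : ℝ → ENNReal} (hr : Measurable r) (m k : ℕ) :
    ∫⁻ ω, idleReward P U S r m (workloadBefore U S k ω) ∂P
      = ∑ j ∈ Finset.range (k + 1), busyStart P U S j * idleReward P U S r (m + (k - j)) 0 := by
  induction k generalizing m with
  | zero => simp [busyStart, workloadBefore]
  | succ k ih =>
    have hm := h.measurable_idleReward hr m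
    have hΦ : Measurable fun q : ℝ × (ℝ × ℝ) =>
        if 0 ≤ q.1 + q.2.2 - q.2.1 then idleReward P U S r m (q.1 + q.2.2 - q.2.1) else 0 := by
      refine Measurable.ite ?_ (hm.comp (by fun_prop)) measurable_const
      exact measurableSet_le measurable_const (by fun_prop)
    have key := h.lintegral_past (measurable_past_workloadBefore U S k) hΦ
    simp only at key
    set A : Set Ω := {ω | workloadBefore U S k ω + S k ω - U k ω < 0} with hA
    have hAm : MeasurableSet A := measurableSet_lt (((h.measurable_workloadBefore k).add
      (h.measurable_service k)).sub (h.measurable_interarrival k)) measurable_const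
    have e : ∀ ω, idleReward P U S r m (workloadBefore U S (k + 1) ω)
        = (if 0 ≤ workloadBefore U S k ω + S k ω - U k ω then
            idleReward P U S r m (workloadBefore U S k ω + S k ω - U k ω) else 0)
          + A.indicator (fun _ => idleReward P U S r m 0) ω := by
      intro ω
      by_cases hx : 0 ≤ workloadBefore U S k ω + S k ω - U k ω
      · have : ω ∉ A := not_lt.2 hx
        simp [workloadBefore, hx, this]
      · have : ω ∈ A := not_le.1 hx
        simp [workloadBefore, hx, this, (not_le.1 hx).le]
    simp_rw [e]
    rw [lintegral_add_right _ (measurable_const.indicator hAm), key,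
      lintegral_indicator_const hAm, Finset.sum_range_succ]
    congr 1
    · refine (ih (m + 1)).trans (Finset.sum_congr rfl fun j hj => ?_)
      rw [Finset.mem_range] at hj
      rw [show m + 1 + (k - j) = m + (k + 1 - j) by omega]
    · rw [mul_comm]; simp [busyStart, A]

/-- The renewal equation of the idle times. -/
lemma lintegral_idleTime (h : IsInput P U S) {r : ℝ → ENNReal} (hr : Measurable r) (k : ℕ) :
    ∫⁻ ω, r (idleTime U S k ω) ∂P
      = ∑ j ∈ Finset.range (k + 1), busyStart P U S j *
        ∫⁻ ω, ENNReal.ofReal (busyIndicator U S (k - j) ω) * r (idleTime U S (k - j) ω) ∂P := by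
  have := h.lintegral_mul_idleTime hr (k := k) (Z := fun _ => 1) measurable_const
    fun _ => ENNReal.one_ne_top
  simp only [one_mul] at this
  rw [this, h.lintegral_idleReward hr]
  simp_rw [h.lintegral_busyIndicator_mul_idleTime hr, zero_add]

lemma busyStart_le_one (k : ℕ) : busyStart P U S k ≤ 1 := by
  cases k with
  | zero => exact le_rfl
  | succ k => exact prob_le_one

lemma integral_idleTime_pow (h : IsInput P U S) (hU : MemLp (U 0) 2 P) (hS : MemLp (S 0) 2 P)
    {p : ℕ} (hp2 : p ≤ 2) (k : ℕ) :
    ∫ ω, idleTime U S k ω ^ p ∂P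
      = ∑ j ∈ Finset.range (k + 1), (busyStart P U S j).toReal *
        ∫ ω, busyIndicator U S (k - j) ω * idleTime U S (k - j) ω ^ p ∂P := by
  have hi : ∀ k, Integrable (fun ω => idleTime U S k ω ^ p) P := by
    intro k
    have hI := h.memLp_idleTime hU hS k
    interval_cases p
    · simp
    · simpa using hI.integrable (by norm_num)
    · exact hI.integrable_sq
  have hn : ∀ k ω, 0 ≤ busyIndicator U S k ω * idleTime U S k ω ^ p := fun k ω =>
    mul_nonneg (busyIndicator_nonneg U S k ω) (pow_nonneg (idleTime_nonneg U S k ω) p)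
  have hr : Measurable fun x : ℝ => ENNReal.ofReal (x ^ p) := by fun_prop
  have key := h.lintegral_idleTime hr k
  rw [← ofReal_integral_eq_lintegral_ofReal (hi k)
    (ae_of_all _ fun ω => pow_nonneg (idleTime_nonneg U S k ω) p)] at key
  have e : ∀ i, ∫⁻ ω, ENNReal.ofReal (busyIndicator U S i ω)
      * ENNReal.ofReal (idleTime U S i ω ^ p) ∂P
      = ENNReal.ofReal (∫ ω, busyIndicator U S i ω * idleTime U S i ω ^ p ∂P) := by
    intro i
    rw [ofReal_integral_eq_lintegral_ofReal (h.integrable_busyIndicator_mul i (hi i))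
      (ae_of_all _ (hn i))]
    refine lintegral_congr fun ω => ?_
    rw [ENNReal.ofReal_mul (busyIndicator_nonneg U S i ω)]
  simp_rw [e] at key
  have := congrArg ENNReal.toReal key
  rw [ENNReal.toReal_ofReal (integral_nonneg fun ω => pow_nonneg (idleTime_nonneg U S k ω) p),
    ENNReal.toReal_sum fun j _ => ENNReal.mul_ne_top
      ((busyStart_le_one j).trans_lt ENNReal.one_lt_top).ne ENNReal.ofReal_ne_top] at this
  rw [this]
  refine Finset.sum_congr rfl fun j _ => ?_
  rw [ENNReal.toReal_mul, ENNReal.toReal_ofReal (integral_nonneg (hn _))]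

end IsInput

/-- If `e = u * a` is the convolution of a bounded sequence `u` and a summable sequence `a` with
nonzero sum, then the Cesàro averages of `u` are determined by those of `e`. -/
lemma tendsto_cesaro_of_convolution {u a e : ℕ → ℝ} {A d : ℝ} (hu0 : ∀ j, 0 ≤ u j)
    (hu1 : ∀ j, u j ≤ 1) (ha : HasSum a A) (ha0 : ∀ j, 0 ≤ a j) (hA : 0 < A)
    (he : ∀ k, e k = ∑ j ∈ Finset.range (k + 1), u j * a (k - j))
    (hlim : Tendsto (fun n : ℕ => (n : ℝ)⁻¹ * ∑ k ∈ Finset.range n, e k) atTop (𝓝 d)) :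
    Tendsto (fun n : ℕ => (n : ℝ)⁻¹ * ∑ j ∈ Finset.range n, u j) atTop (𝓝 (d / A)) := by
  have hA1 : Tendsto (fun n : ℕ => A - ∑ i ∈ Finset.range (n + 1), a i) atTop (𝓝 0) := by
    have := (ha.tendsto_sum_nat.comp (tendsto_add_atTop_nat 1)).const_sub A
    simpa using this
  have hces := hA1.cesaro
  have hA0 : ∀ n, 0 ≤ A - ∑ i ∈ Finset.range n, a i := fun n =>
    sub_nonneg.2 (sum_le_hasSum _ (fun i _ => ha0 i) ha)
  have hsum : ∀ n, ∑ k ∈ Finset.range n, e k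
      = ∑ j ∈ Finset.range n, u j * ∑ i ∈ Finset.range (n - j), a i := by
    intro n
    simp_rw [he, Finset.mul_sum]
    exact Finset.sum_range_diag_flip n fun j i => u j * a i
  -- Replacing the partial sums of `a` by `A` costs only tails of the series. As `u ≤ 1`, reversing
  -- the order of summation bounds this cost by a Cesàro mean of tails, which tends to `0`.
  have hdiff : Tendsto (fun n : ℕ => (n : ℝ)⁻¹ *
      ∑ j ∈ Finset.range n, u j * (A - ∑ i ∈ Finset.range (n - j), a i)) atTop (𝓝 0) := by
    refine squeeze_zero (fun n => ?_) (fun n => ?_) hces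
    · exact mul_nonneg (by positivity) (Finset.sum_nonneg fun j _ => mul_nonneg (hu0 j) (hA0 _))
    · refine mul_le_mul_of_nonneg_left ?_ (by positivity)
      rw [← Finset.sum_range_reflect (fun i => A - ∑ i ∈ Finset.range (i + 1), a i)]
      refine Finset.sum_le_sum fun j hj => ?_
      rw [Finset.mem_range] at hj
      rw [show n - 1 - j + 1 = n - j by omega]
      exact mul_le_of_le_one_left (hA0 _) (hu1 j)
  have := (hlim.add hdiff).div_const A
  rw [add_zero] at this
  refine this.congr fun n => ?_
  rw [hsum, ← mul_add, ← Finset.sum_add_distrib]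
  simp_rw [← mul_add, add_sub_cancel, ← Finset.sum_mul]
  field_simp

lemma sum_convolution_le {u a e : ℕ → ℝ} {A : ℝ} (hu0 : ∀ j, 0 ≤ u j)
    (ha : HasSum a A) (ha0 : ∀ j, 0 ≤ a j)
    (he : ∀ k, e k = ∑ j ∈ Finset.range (k + 1), u j * a (k - j)) (n : ℕ) :
    ∑ k ∈ Finset.range n, e k ≤ A * ∑ j ∈ Finset.range n, u j := by
  have hsum : ∑ k ∈ Finset.range n, e k
      = ∑ j ∈ Finset.range n, u j * ∑ i ∈ Finset.range (n - j), a i := by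
    simp_rw [he, Finset.mul_sum]
    exact Finset.sum_range_diag_flip n fun j i => u j * a i
  rw [hsum, mul_comm, Finset.sum_mul]
  exact Finset.sum_le_sum fun j _ => mul_le_mul_of_nonneg_left
    (sum_le_hasSum _ (fun i _ => ha0 i) ha) (hu0 j)

namespace IsInput

variable [IsProbabilityMeasure P]

lemma integral_idlePeriod_pos (h : IsInput P U S) (hU : MemLp (U 0) 2 P)
    (hS : MemLp (S 0) 2 P) (hdrift : ∫ ω, S 0 ω ∂P < ∫ ω, U 0 ω ∂P) :
    0 < ∫ ω, idlePeriod U S ω ∂P := by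
  have hi := (h.hasSum_integral_idlePeriod hU hS hdrift one_ne_zero one_le_two).1
  simp only [pow_one] at hi
  have hpos := h.ae_idlePeriod_pos hU hS hdrift
  rw [integral_pos_iff_support_of_nonneg_ae (hpos.mono fun ω hω => hω.le) hi]
  have : P (Function.support (idlePeriod U S)) = 1 := by
    rw [prob_compl_eq_zero_iff₀ ?_ |>.symm]
    · exact hpos.mono fun ω hω => hω.ne'
    · exact hi.1.nullMeasurableSet_support
  rw [this]
  exact one_pos

/-- The long-run average of the squared idle times per customer is bounded through the first two
moments of the idle period. -/
lemma exists_tendsto_sum_sq_idleTime_le (h : IsInput P U S) (hU : MemLp (U 0) 2 P)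
    (hS : MemLp (S 0) 2 P) (hdrift : ∫ ω, S 0 ω ∂P < ∫ ω, U 0 ω ∂P) :
    ∃ b : ℕ → ℝ, (∀ n : ℕ, (n : ℝ)⁻¹ * ∑ k ∈ Finset.range n, ∫ ω, idleTime U S k ω ^ 2 ∂P ≤ b n) ∧
      Tendsto b atTop (𝓝 ((∫ ω, idlePeriod U S ω ^ 2 ∂P) *
        ((∫ ω, U 0 ω ∂P - ∫ ω, S 0 ω ∂P) / ∫ ω, idlePeriod U S ω ∂P))) := by
  have h1 := (h.hasSum_integral_idlePeriod hU hS hdrift one_ne_zero one_le_two).2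
  have h2 := (h.hasSum_integral_idlePeriod hU hS hdrift two_ne_zero le_rfl).2
  simp only [pow_one] at h1
  -- First moments are used to find the frequency of restarts, since there the average of `e` is
  -- already known; for second moments the inequality `sum_convolution_le` is then enough.
  have hlim := tendsto_cesaro_of_convolution (u := fun j => (busyStart P U S j).toReal)
    (e := fun k => ∫ ω, idleTime U S k ω ∂P)
    (fun j => ENNReal.toReal_nonneg)
    (fun j => ENNReal.toReal_le_of_le_ofReal zero_le_one (by simpa using busyStart_le_one j)) h1
    (fun k => integral_nonneg fun ω => mul_nonneg (busyIndicator_nonneg U S k ω)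
      (idleTime_nonneg U S k ω))
    (h.integral_idlePeriod_pos hU hS hdrift)
    (fun k => by simpa using h.integral_idleTime_pow hU hS one_le_two k)
    (h.tendsto_sum_integral_idleTime hU hS hdrift.le)
  refine ⟨_, fun n => ?_, hlim.const_mul _⟩
  have h3 := sum_convolution_le (u := fun j => (busyStart P U S j).toReal)
    (e := fun k => ∫ ω, idleTime U S k ω ^ 2 ∂P) (fun j => ENNReal.toReal_nonneg) h2
    (fun k => integral_nonneg fun ω => mul_nonneg (busyIndicator_nonneg U S k ω)
      (sq_nonneg _)) (fun k => h.integral_idleTime_pow hU hS le_rfl k) n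
  calc _ ≤ (n : ℝ)⁻¹ * ((∫ ω, idlePeriod U S ω ^ 2 ∂P) *
        ∑ j ∈ Finset.range n, (busyStart P U S j).toReal) :=
      mul_le_mul_of_nonneg_left h3 (by positivity)
    _ = _ := by ring

end IsInput

end GG1

end

/-! ### The Stein equation of the exponential distribution -/

noncomputable section

namespace GG1

lemma integral_expMeasure (r : ℝ) (hr : 0 < r) (f : ℝ → ℝ) :
    ∫ y, f y ∂(expMeasure r) = ∫ y in Set.Ioi 0, r * Real.exp (-(r * y)) * f y := by
  have h1 : ∫ y, f y ∂(expMeasure r) = ∫ y, (exponentialPDF r y).toReal * f y := by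
    rw [expMeasure, gammaMeasure, integral_withDensity_eq_integral_toReal_smul
      (show Measurable (gammaPDF 1 r) from (measurable_gammaPDFReal 1 r).ennreal_ofReal) (ae_of_all _ fun x => ENNReal.ofReal_lt_top)]
    rfl
  rw [h1, ← integral_Ici_eq_integral_Ioi, ← integral_indicator measurableSet_Ici]
  refine integral_congr_ae (ae_of_all _ fun y => ?_)
  by_cases hy : 0 ≤ y
  · simp only [Set.indicator_of_mem (Set.mem_Ici.2 hy)]
    rw [exponentialPDF_of_nonneg hy, ENNReal.toReal_ofReal (by positivity)]
  · rw [Set.indicator_of_notMem (by simpa using hy)]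
    simp [exponentialPDF_of_neg (not_le.1 hy)]

lemma integrable_id_expMeasure {r : ℝ} (hr : 0 < r) : Integrable (fun y : ℝ => y) (expMeasure r) := by
  rw [expMeasure, gammaMeasure, integrable_withDensity_iff_integrable_smul'
    (show Measurable (gammaPDF 1 r) from (measurable_gammaPDFReal 1 r).ennreal_ofReal) (ae_of_all _ fun x => ENNReal.ofReal_lt_top)]
  have h2 : IntegrableOn (fun x : ℝ => r * (x ^ (1 : ℝ) * Real.exp (-r * x ^ (1 : ℝ)))) (Set.Ioi 0) :=
    (integrableOn_rpow_mul_exp_neg_mul_rpow (by norm_num) one_pos hr).const_mul r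
  rw [← integrableOn_Ici_iff_integrableOn_Ioi, ← integrable_indicator_iff measurableSet_Ici] at h2
  refine h2.congr (ae_of_all _ fun y => ?_)
  change _ = (exponentialPDF r y).toReal • y
  by_cases hy : 0 ≤ y
  · simp only [Set.indicator_of_mem (Set.mem_Ici.2 hy)]
    rw [exponentialPDF_of_nonneg hy, ENNReal.toReal_ofReal (by positivity)]
    simp only [Real.rpow_one, smul_eq_mul]
    ring_nf
  · rw [Set.indicator_of_notMem (by simpa using hy)]
    simp [exponentialPDF_of_neg (not_le.1 hy)]

/-- The bounded solution `g` of the Stein equation `g' / r - g = h - 𝔼 h(Y)` of the exponential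
distribution with rate `r`. -/
def steinSolution (r : ℝ) (h : ℝ → ℝ) (x : ℝ) : ℝ :=
  ∫ y, h y ∂(expMeasure r) - ∫ y, h (x + y) ∂(expMeasure r)

section Stein

variable {r : ℝ} {h : ℝ → ℝ} {M : ℝ}

lemma integrable_comp_add_expMeasure (hr : 0 < r) (hc : Continuous h) (hM : ∀ x, |h x| ≤ M)
    (x : ℝ) : Integrable (fun y => h (x + y)) (expMeasure r) := by
  have := isProbabilityMeasure_expMeasure hr
  exact Integrable.of_bound (by fun_prop) M (ae_of_all _ fun y => hM _)

lemma steinSolution_zero : steinSolution r h 0 = 0 := by simp [steinSolution]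

lemma abs_steinSolution_sub_le (hr : 0 < r) (hL : LipschitzWith 1 h) (hM : ∀ x, |h x| ≤ M)
    (x z : ℝ) : |steinSolution r h x - steinSolution r h z| ≤ |x - z| := by
  have := isProbabilityMeasure_expMeasure hr
  have hi := integrable_comp_add_expMeasure hr hL.continuous hM
  simp only [steinSolution, sub_sub_sub_cancel_left]
  rw [← integral_sub (hi z) (hi x)]
  have := norm_integral_le_of_norm_le_const (μ := expMeasure r) (C := |x - z|)
    (f := fun y => h (z + y) - h (x + y)) (ae_of_all _ fun y => by
      have := hL.dist_le_mul (z + y) (x + y)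
      simpa [Real.dist_eq, abs_sub_comm] using this)
  simpa using this

lemma abs_integral_expMeasure_le (hr : 0 < r) (hM : ∀ x, |h x| ≤ M) (x : ℝ) :
    |∫ y, h (x + y) ∂(expMeasure r)| ≤ M := by
  have := isProbabilityMeasure_expMeasure hr
  have := norm_integral_le_of_norm_le_const (μ := expMeasure r) (C := M)
    (f := fun y => h (x + y)) (ae_of_all _ fun y => hM _)
  simpa using this

lemma abs_steinSolution_le (hr : 0 < r) (hM : ∀ x, |h x| ≤ M) (x : ℝ) :
    |steinSolution r h x| ≤ 2 * M := by
  have h1 := abs_integral_expMeasure_le hr hM x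
  have h2 := abs_integral_expMeasure_le hr hM 0
  simp only [zero_add] at h2
  rw [steinSolution]
  linarith [abs_sub (∫ y, h y ∂(expMeasure r)) (∫ y, h (x + y) ∂(expMeasure r))]

/-- The substitution `z = x + y` moves the dependence on `x` out of `h` into an exponential factor
and an integration limit, so that the Stein solution is differentiable for `h` merely continuous and
bounded. -/
lemma integral_comp_add_expMeasure (hr : 0 < r) (hc : Continuous h) (hM : ∀ x, |h x| ≤ M)
    (x : ℝ) : ∫ y, h (x + y) ∂(expMeasure r)
      = Real.exp (r * x) * (∫ y, h y ∂(expMeasure r)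
        - ∫ z in (0 : ℝ)..x, r * Real.exp (-(r * z)) * h z) := by
  have hint : ∀ a, IntegrableOn (fun z => r * Real.exp (-(r * z)) * h z) (Set.Ioi a) := by
    intro a
    have h1 : IntegrableOn (fun z => r * Real.exp (-(r * z))) (Set.Ioi a) := by
      have := (exp_neg_integrableOn_Ioi a hr).const_mul r
      simp only [neg_mul] at this
      exact this
    have h2 : IntegrableOn (fun z => h z * (r * Real.exp (-(r * z)))) (Set.Ioi a) :=
      Integrable.bdd_mul (c := M) h1 (by fun_prop) (ae_of_all _ hM)
    simpa only [mul_comm] using h2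
  rw [integral_expMeasure r hr, integral_expMeasure r hr,
    ← intervalIntegral.integral_Ioi_sub_Ioi' (hint 0) (hint x), sub_sub_cancel,
    ← integral_indicator measurableSet_Ioi, ← integral_indicator measurableSet_Ioi,
    ← integral_const_mul,
    ← integral_add_left_eq_self (fun z => Real.exp (r * x)
      * (Set.Ioi x).indicator (fun z => r * Real.exp (-(r * z)) * h z) z) x]
  refine integral_congr_ae (ae_of_all _ fun y => ?_)
  by_cases hy : 0 < y
  · have h1 : y ∈ Set.Ioi (0 : ℝ) := hy
    have h2 : x + y ∈ Set.Ioi x := by simpa using hy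
    simp only [Set.indicator_of_mem h1, Set.indicator_of_mem h2]
    rw [show -(r * y) = r * x + -(r * (x + y)) by ring, Real.exp_add]
    ring
  · have h1 : y ∉ Set.Ioi (0 : ℝ) := hy
    have h2 : x + y ∉ Set.Ioi x := by simpa using hy
    simp only [Set.indicator_of_notMem h1, Set.indicator_of_notMem h2, mul_zero]

lemma hasDerivAt_steinSolution (hr : 0 < r) (hc : Continuous h) (hM : ∀ x, |h x| ≤ M) (x : ℝ) :
    HasDerivAt (steinSolution r h)
      (r * (steinSolution r h x + h x - ∫ y, h y ∂(expMeasure r))) x := by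
  have e : steinSolution r h = fun x => ∫ y, h y ∂(expMeasure r)
      - Real.exp (r * x) * (∫ y, h y ∂(expMeasure r)
        - ∫ z in (0 : ℝ)..x, r * Real.exp (-(r * z)) * h z) := by
    funext x
    rw [steinSolution, integral_comp_add_expMeasure hr hc hM]
  have hcont : Continuous fun z => r * Real.exp (-(r * z)) * h z := by fun_prop
  have h1 : HasDerivAt (fun x => ∫ z in (0 : ℝ)..x, r * Real.exp (-(r * z)) * h z)
      (r * Real.exp (-(r * x)) * h x) x := hcont.integral_hasStrictDerivAt 0 x |>.hasDerivAt
  have h2 : HasDerivAt (fun x => Real.exp (r * x)) (Real.exp (r * x) * (r * 1)) x :=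
    ((hasDerivAt_id x).const_mul r).exp
  have h3 := (h2.mul (h1.const_sub (∫ y, h y ∂(expMeasure r)))).const_sub
    (∫ y, h y ∂(expMeasure r))
  rw [e]
  refine h3.congr_deriv ?_
  have hexp : Real.exp (r * x) * Real.exp (-(r * x)) = 1 := by
    rw [← Real.exp_add]; simp
  linear_combination (r * h x) * hexp

end Stein

/-! ### Pathwise estimates over a single cycle -/

section Deterministic

variable {F G g : ℝ → ℝ} {L C : ℝ}

lemma abs_le_mul_abs_of_hasDerivAt {ψ ψ' : ℝ → ℝ} {K x : ℝ} (h0 : ψ 0 = 0)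
    (hd : ∀ y, HasDerivAt ψ (ψ' y) y) (hb : ∀ y, |y| ≤ |x| → |ψ' y| ≤ K) :
    |ψ x| ≤ K * |x| := by
  have := Convex.norm_image_sub_le_of_norm_hasDerivWithin_le (f := ψ) (f' := ψ') (C := K)
    (s := Set.uIcc 0 x) (x := 0) (y := x) (fun y _ => (hd y).hasDerivWithinAt)
    (fun y hy => hb y (by simpa using Set.abs_sub_left_of_mem_uIcc hy)) (convex_uIcc 0 x)
    Set.left_mem_uIcc Set.right_mem_uIcc
  simpa [h0] using this

/-- Second-order Taylor expansion of a function with Lipschitz second derivative. -/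
lemma abs_taylor_two_le (hF : ∀ x, HasDerivAt F (G x) x) (hG : ∀ x, HasDerivAt G (g x) x)
    (hC : ∀ x y, |g x - g y| ≤ C * |x - y|) (hC0 : 0 ≤ C) (w x : ℝ) :
    |F (w + x) - F w - G w * x - g w * (x ^ 2 / 2)| ≤ C * |x| ^ 3 := by
  -- The mean value inequality, here and again for `F`, yields the constant `1` rather than `1 / 6`;
  -- this is the constant that leads to the factor `4` in the theorem.
  have h1 : ∀ y, |G (w + y) - G w - g w * y| ≤ C * |y| * |y| := by
    intro y
    refine abs_le_mul_abs_of_hasDerivAt (ψ := fun y => G (w + y) - G w - g w * y)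
      (ψ' := fun y => g (w + y) - g w) (by simp) (fun z => ?_) (fun z hz => ?_)
    · exact ((((hG (w + z)).comp_const_add w z).sub_const (G w)).sub
        ((hasDerivAt_id z).const_mul (g w))).congr_deriv (by simp)
    · have := hC (w + z) w
      simp only [add_sub_cancel_left] at this
      exact this.trans (by gcongr)
  have h2 := abs_le_mul_abs_of_hasDerivAt (x := x) (K := C * |x| * |x|)
      (ψ := fun y => F (w + y) - F w - G w * y - g w * (y ^ 2 / 2))
      (ψ' := fun y => G (w + y) - G w - g w * y) (by simp) (fun z => ?_)
      (fun z hz => (h1 z).trans (by gcongr))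
  · calc _ ≤ _ := h2
      _ = _ := by ring
  · have e1 := ((((hF (w + z)).comp_const_add w z).sub_const (F w)).sub
        ((hasDerivAt_id z).const_mul (G w)))
    have e2 := ((((hasDerivAt_id z).pow 2).div_const 2).const_mul (g w))
    refine (e1.sub e2).congr_deriv ?_
    simp

/-- Along a cycle with initial workload `v` and length `u`, the increment of `F(V - ρ R)` is close
to the integral of the drift term. -/
lemma abs_cycle_drift_le (hF : ∀ x, HasDerivAt F (G x) x)
    (hL : ∀ x y, |G x - G y| ≤ L * |x - y|) (hL0 : 0 ≤ L) (hG0 : G 0 = 0) {ρ : ℝ} (hρ0 : 0 ≤ ρ)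
    (hρ1 : ρ ≤ 1) {v u : ℝ} (hv : 0 ≤ v) (hu : 0 ≤ u) :
    |F (max (v - u) 0) - F (v - ρ * u) + (1 - ρ) * ∫ s in (0 : ℝ)..u, G (max (v - s) 0)|
      ≤ (1 - ρ) * ρ * L * (u ^ 2 / 2) + ρ * L * (max (u - v) 0 ^ 2 / 2) := by
  have hGc : Continuous G := by
    refine (LipschitzWith.of_dist_le_mul (K := ⟨L, hL0⟩) fun x y => ?_).continuous
    exact hL x y
  -- While work remains, the derivative in `u` is `ρ (G (v - ρ u) - G (v - u))`, at most `ρ L (1 -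
  -- ρ) u` in absolute value.
  have hbusy : ∀ u, 0 ≤ u → |F (v - u) - F (v - ρ * u) + (1 - ρ) * ∫ s in (0 : ℝ)..u, G (v - s)|
      ≤ (1 - ρ) * ρ * L * (u ^ 2 / 2) := by
    intro u hu
    have hd : ∀ x, HasDerivAt (fun u => F (v - u) - F (v - ρ * u)
        + (1 - ρ) * ∫ s in (0 : ℝ)..u, G (v - s)) (ρ * (G (v - ρ * x) - G (v - x))) x := by
      intro x
      have d1 : HasDerivAt (fun u => F (v - u)) (G (v - x) * -1) x :=
        (hF (v - x)).comp x ((hasDerivAt_id x).const_sub v)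
      have d2 : HasDerivAt (fun u => F (v - ρ * u)) (G (v - ρ * x) * -(ρ * 1)) x :=
        (hF (v - ρ * x)).comp x (((hasDerivAt_id x).const_mul ρ).const_sub v)
      have hc : Continuous fun s => G (v - s) := by fun_prop
      have d3 : HasDerivAt (fun u => ∫ s in (0 : ℝ)..u, G (v - s)) (G (v - x)) x :=
        (hc.integral_hasStrictDerivAt 0 x).hasDerivAt
      exact ((d1.sub d2).add (d3.const_mul (1 - ρ))).congr_deriv (by ring)
    have hB : ∀ x, HasDerivAt (fun u : ℝ => (1 - ρ) * ρ * L * (u ^ 2 / 2))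
        ((1 - ρ) * ρ * L * x) x := fun x =>
      ((((hasDerivAt_id x).pow 2).div_const 2).const_mul _).congr_deriv (by simp)
    have := image_norm_le_of_norm_deriv_right_le_deriv_boundary (a := 0) (b := u)
      (fun x _ => (hd x).continuousAt.continuousWithinAt) (fun x _ => (hd x).hasDerivWithinAt)
      (by simp) hB (fun x hx => ?_) (Set.right_mem_Icc.2 hu)
    · exact this
    · rw [Real.norm_eq_abs, abs_mul, abs_of_nonneg hρ0]
      have h1 := hL (v - ρ * x) (v - x)
      rw [show v - ρ * x - (v - x) = (1 - ρ) * x by ring,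
        abs_of_nonneg (mul_nonneg (by linarith) hx.1)] at h1
      calc ρ * |G (v - ρ * x) - G (v - x)| ≤ ρ * (L * ((1 - ρ) * x)) := by gcongr
        _ = _ := by ring
  rcases le_total u v with huv | huv
  · rw [max_eq_left (by linarith), max_eq_right (by linarith)]
    have : ∫ s in (0 : ℝ)..u, G (max (v - s) 0) = ∫ s in (0 : ℝ)..u, G (v - s) := by
      refine intervalIntegral.integral_congr fun s hs => ?_
      rw [Set.uIcc_of_le hu] at hs
      rw [max_eq_left (by linarith [hs.2])]
    rw [this]
    simpa using hbusy u hu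
  · rw [max_eq_right (by linarith), max_eq_left (by linarith)]
    have hc : Continuous fun s => G (max (v - s) 0) := by fun_prop
    have e1 : ∫ s in (0 : ℝ)..u, G (max (v - s) 0) = ∫ s in (0 : ℝ)..v, G (v - s) := by
      rw [← intervalIntegral.integral_add_adjacent_intervals (hc.intervalIntegrable 0 v)
        (hc.intervalIntegrable v u)]
      have e2 : ∫ s in v..u, G (max (v - s) 0) = ∫ s in v..u, (0 : ℝ) := by
        refine intervalIntegral.integral_congr fun s hs => ?_
        rw [Set.uIcc_of_le huv] at hs
        rw [max_eq_right (by linarith [hs.1]), hG0]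
      have e3 : ∫ s in (0 : ℝ)..v, G (max (v - s) 0) = ∫ s in (0 : ℝ)..v, G (v - s) := by
        refine intervalIntegral.integral_congr fun s hs => ?_
        rw [Set.uIcc_of_le hv] at hs
        rw [max_eq_left (by linarith [hs.2])]
      rw [e2, e3]
      simp
    -- Once the system is empty, `F` sits at `F 0` and the integral stops growing because `G 0 = 0`;
    -- only `F (v - ρ u)` still varies. The barrier `hB` starts at `0` for `u = v` and, added to the
    -- busy bound at `v`, gives the full right-hand side.
    have hd : ∀ x, HasDerivAt (fun u => F (v - ρ * v) - F (v - ρ * u)) (ρ * G (v - ρ * x)) x := by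
      intro x
      have d2 : HasDerivAt (fun u => F (v - ρ * u)) (G (v - ρ * x) * -(ρ * 1)) x :=
        (hF (v - ρ * x)).comp x (((hasDerivAt_id x).const_mul ρ).const_sub v)
      exact (d2.const_sub _).congr_deriv (by ring)
    have hB : ∀ x, HasDerivAt (fun u : ℝ => (1 - ρ) * ρ * L * ((u ^ 2 - v ^ 2) / 2)
        + ρ * L * ((u - v) ^ 2 / 2)) ((1 - ρ) * ρ * L * x + ρ * L * (x - v)) x := by
      intro x
      have b1 := (((((hasDerivAt_id x).pow 2).sub_const (v ^ 2)).div_const 2).const_mul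
        ((1 - ρ) * ρ * L))
      have b2 := (((((hasDerivAt_id x).sub_const v).pow 2).div_const 2).const_mul (ρ * L))
      exact (b1.add b2).congr_deriv (by simp)
    have hidle := image_norm_le_of_norm_deriv_right_le_deriv_boundary (a := v) (b := u)
      (fun x _ => (hd x).continuousAt.continuousWithinAt) (fun x _ => (hd x).hasDerivWithinAt)
      (by simp) hB (fun x hx => ?_) (Set.right_mem_Icc.2 huv)
    · have hb := hbusy v hv
      rw [sub_self] at hb
      rw [Real.norm_eq_abs] at hidle
      rw [e1]
      have e4 : F 0 - F (v - ρ * u) + (1 - ρ) * ∫ s in (0 : ℝ)..v, G (v - s)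
          = (F 0 - F (v - ρ * v) + (1 - ρ) * ∫ s in (0 : ℝ)..v, G (v - s))
            + (F (v - ρ * v) - F (v - ρ * u)) := by ring
      rw [e4]
      refine (abs_add_le _ _).trans ?_
      linarith
    · rw [Real.norm_eq_abs, abs_mul, abs_of_nonneg hρ0]
      have h1 := hL (v - ρ * x) 0
      rw [hG0, sub_zero, sub_zero] at h1
      have h2 : |v - ρ * x| ≤ (1 - ρ) * x + (x - v) := by
        have h3 := mul_nonneg (sub_nonneg.2 hρ1) (hv.trans hx.1)
        rw [abs_le]
        constructor <;> nlinarith [hx.1]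
      calc ρ * |G (v - ρ * x)| ≤ ρ * (L * ((1 - ρ) * x + (x - v))) := by
            gcongr; exact h1.trans (by gcongr)
        _ = _ := by ring

/-- The integral over a cycle compared with the value just before its first arrival. -/
lemma abs_cycle_integral_sub_le (hC : ∀ x y, |g x - g y| ≤ C * |x - y|) (hC0 : 0 ≤ C)
    {w s u : ℝ} (hw : 0 ≤ w) (hs : 0 ≤ s) (hu : 0 ≤ u) :
    |g w * u - ∫ t in (0 : ℝ)..u, g (max (w + s - t) 0)| ≤ C * (s * u + u ^ 2 / 2) := by
  have hgc : Continuous g := by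
    refine (LipschitzWith.of_dist_le_mul (K := ⟨C, hC0⟩) fun x y => ?_).continuous
    exact hC x y
  have hc : Continuous fun t => g (max (w + s - t) 0) := by fun_prop
  have e : g w * u - ∫ t in (0 : ℝ)..u, g (max (w + s - t) 0)
      = ∫ t in (0 : ℝ)..u, (g w - g (max (w + s - t) 0)) := by
    rw [intervalIntegral.integral_sub (by simp) (hc.intervalIntegrable _ _)]
    simp [mul_comm]
  have e2 : ∫ t in (0 : ℝ)..u, C * (s + t) = C * (s * u + u ^ 2 / 2) := by
    rw [intervalIntegral.integral_const_mul, intervalIntegral.integral_add (by simp) (by simp)]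
    simp [mul_comm]
  rw [e, ← e2, ← Real.norm_eq_abs]
  refine intervalIntegral.norm_integral_le_of_norm_le hu (ae_of_all _ fun t ht => ?_)
    (Continuous.intervalIntegrable (by fun_prop) _ _)
  refine (hC _ _).trans (mul_le_mul_of_nonneg_left ?_ hC0)
  have ht0 := ht.1
  rw [abs_le]
  rcases le_total (w + s - t) 0 with h | h
  · rw [max_eq_right h]; constructor <;> linarith
  · rw [max_eq_left h]; constructor <;> linarith

end Deterministic

end GG1

end

/-! ### From time averages of the workload to cycle averages -/

noncomputable section

namespace GG1

variable {Ω : Type*} {U S : ℕ → Ω → ℝ}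

/-- Over the first `n` cycles, the integral of a function of the workload splits into integrals
over the interarrival times. -/
lemma integral_workload_eq_sum {ω : Ω} (hU : ∀ n, 0 ≤ U n ω) {φ : ℝ → ℝ} (hφ : Continuous φ)
    (n : ℕ) :
    IntervalIntegrable (fun t => φ (workload U S t ω)) volume 0 (arrivalTime U n ω) ∧
    ∫ t in (0 : ℝ)..arrivalTime U n ω, φ (workload U S t ω)
      = ∑ k ∈ Finset.range n, ∫ s in (0 : ℝ)..U k ω,
        φ (max (workloadBefore U S k ω + S k ω - s) 0) := by
  induction n with
  | zero => simp [arrivalTime]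
  | succ n ih =>
    have hle : arrivalTime U n ω ≤ arrivalTime U (n + 1) ω := arrivalTime_mono hU n.le_succ
    have hc : Continuous fun t =>
        φ (max (workloadBefore U S n ω + S n ω - (t - arrivalTime U n ω)) 0) := by fun_prop
    have hae : ∀ᵐ t, t ∈ Set.uIoc (arrivalTime U n ω) (arrivalTime U (n + 1) ω) →
        φ (max (workloadBefore U S n ω + S n ω - (t - arrivalTime U n ω)) 0)
          = φ (workload U S t ω) := by
      -- At the right endpoint the next customer is already counted, so this single point is
      -- discarded.
      filter_upwards [compl_mem_ae_iff.2 (measure_singleton (arrivalTime U (n + 1) ω))] with t ht ht'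
      rw [Set.uIoc_of_le hle] at ht'
      rw [workload_eq hU ht'.1.le (lt_of_le_of_ne ht'.2 ht)]
    have hi2 : IntervalIntegrable (fun t => φ (workload U S t ω)) volume
        (arrivalTime U n ω) (arrivalTime U (n + 1) ω) :=
      (hc.intervalIntegrable _ _).congr_ae
        ((ae_restrict_iff' measurableSet_uIoc).2 hae)
    refine ⟨ih.1.trans hi2, ?_⟩
    rw [← intervalIntegral.integral_add_adjacent_intervals ih.1 hi2, ih.2, Finset.sum_range_succ,
      ← intervalIntegral.integral_congr_ae hae]
    congr 1
    rw [intervalIntegral.integral_comp_sub_right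
      (fun s => φ (max (workloadBefore U S n ω + S n ω - s) 0)) (arrivalTime U n ω), sub_self,
      arrivalTime_succ, add_sub_cancel_left]

variable [MeasurableSpace Ω] {P : Measure Ω}

namespace IsInput

lemma measurable_arrivalTime (h : IsInput P U S) (n : ℕ) : Measurable (arrivalTime U n) :=
  Finset.measurable_sum _ fun k _ => h.measurable_interarrival k

lemma measurable_lastArrival (h : IsInput P U S) :
    Measurable fun p : ℝ × Ω => lastArrival U p.1 p.2 := by
  have hA : ∀ n, MeasurableSet {p : ℝ × Ω | arrivalTime U n p.2 ≤ p.1} := fun n =>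
    measurableSet_le ((h.measurable_arrivalTime n).comp measurable_snd) measurable_fst
  -- A positive supremum is attained. The value `0` is also the default for empty or unbounded sets,
  -- so its level set is handled as the complement of the others.
  have hpos : ∀ m : ℕ, MeasurableSet {p : ℝ × Ω | lastArrival U p.1 p.2 = m + 1} := by
    intro m
    have e : {p : ℝ × Ω | lastArrival U p.1 p.2 = m + 1}
        = {p : ℝ × Ω | arrivalTime U (m + 1) p.2 ≤ p.1} ∩
          ⋂ n ∈ Set.Ioi (m + 1), {p : ℝ × Ω | arrivalTime U n p.2 ≤ p.1}ᶜ := by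
      ext p
      simp only [Set.mem_inter_iff, Set.mem_iInter, Set.mem_compl_iff, Set.mem_ofPred_eq,
        Set.mem_Ioi, lastArrival]
      constructor
      · intro hp
        have hne : {n : ℕ | arrivalTime U n p.2 ≤ p.1}.Nonempty := by
          by_contra! hemp
          rw [hemp, csSup_empty] at hp
          exact absurd hp.symm (Nat.succ_ne_zero m)
        have hbdd : BddAbove {n : ℕ | arrivalTime U n p.2 ≤ p.1} := by
          by_contra hb
          rw [Nat.sSup_of_not_bddAbove hb] at hp
          exact absurd hp.symm (Nat.succ_ne_zero m)
        have hmem := Nat.sSup_mem hne hbdd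
        rw [hp] at hmem
        refine ⟨hmem, fun n hn hn' => ?_⟩
        have := le_csSup hbdd hn'
        omega
      · rintro ⟨h1, h2⟩
        refine IsGreatest.csSup_eq ⟨h1, fun n hn => ?_⟩
        by_contra! hlt
        exact h2 n hlt hn
    rw [e]
    exact (hA _).inter (MeasurableSet.biInter (Set.to_countable _) fun n _ => (hA n).compl)
  refine measurable_to_countable' fun m => ?_
  cases m with
  | succ m => exact hpos m
  | zero =>
    have e : (fun p : ℝ × Ω => lastArrival U p.1 p.2) ⁻¹' {0}
        = (⋃ m : ℕ, {p : ℝ × Ω | lastArrival U p.1 p.2 = m + 1})ᶜ := by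
      ext p
      simp only [Set.mem_preimage, Set.mem_singleton_iff, Set.mem_compl_iff, Set.mem_iUnion,
        Set.mem_ofPred_eq, not_exists]
      constructor
      · intro hp m
        omega
      · intro hp
        by_contra hne
        exact hp (lastArrival U p.1 p.2 - 1) (by omega)
    rw [e]
    exact (MeasurableSet.iUnion hpos).compl

lemma measurable_workload (h : IsInput P U S) :
    Measurable fun p : ℝ × Ω => workload U S p.1 p.2 := by
  have h1 : Measurable fun q : (ℝ × Ω) × ℕ => max (workloadBefore U S q.2 q.1.2 + S q.2 q.1.2
      - (q.1.1 - arrivalTime U q.2 q.1.2)) 0 := by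
    refine measurable_from_prod_countable_left fun n => ?_
    have hW := h.measurable_workloadBefore n
    have hS := h.measurable_service n
    have hT := h.measurable_arrivalTime n
    exact ((hW.comp measurable_snd).add (hS.comp measurable_snd)).sub
      (measurable_fst.sub (hT.comp measurable_snd)) |>.max measurable_const
  exact h1.comp (measurable_id.prodMk h.measurable_lastArrival)

variable [IsProbabilityMeasure P]

lemma tendsto_integral_abs_arrivalTime_sub (h : IsInput P U S) (hU : Integrable (U 0) P) :
    Tendsto (fun n : ℕ => (n : ℝ)⁻¹ * ∫ ω, |arrivalTime U n ω - n * ∫ ω, U 0 ω ∂P| ∂P) atTop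
      (𝓝 0) := by
  have key := strong_law_Lp (p := 1) le_rfl ENNReal.one_ne_top U (memLp_one_iff_integrable.2 hU)
    (fun i j hij => h.indep.indepFun (i := Sum.inl i) (j := Sum.inl j) (by simpa using hij))
    h.identDistrib_interarrival
  have key2 := (ENNReal.tendsto_toReal ENNReal.zero_ne_top).comp key
  simp only [ENNReal.toReal_zero] at key2
  refine key2.congr' ?_
  filter_upwards [eventually_gt_atTop 0] with n hn
  have hn' : (0 : ℝ) < n := by exact_mod_cast hn
  have hTi : Integrable (arrivalTime U n) P :=
    integrable_finsetSum _ fun k _ => (h.identDistrib_interarrival k).integrable_iff.2 hU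
  have hi : AEStronglyMeasurable (fun ω => (n : ℝ)⁻¹ • (∑ i ∈ Finset.range n, U i ω)
      - ∫ ω, U 0 ω ∂P) P :=
    (hTi.1.const_smul ((n : ℝ)⁻¹)).sub aestronglyMeasurable_const
  rw [Function.comp_apply, eLpNorm_one_eq_lintegral_enorm, ← integral_norm_eq_lintegral_enorm hi,
    ← integral_const_mul]
  refine integral_congr_ae (ae_of_all _ fun ω => ?_)
  simp only [smul_eq_mul, Real.norm_eq_abs, arrivalTime]
  rw [show (n : ℝ)⁻¹ * ∑ i ∈ Finset.range n, U i ω - ∫ ω, U 0 ω ∂P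
    = (n : ℝ)⁻¹ * (∑ i ∈ Finset.range n, U i ω - n * ∫ ω, U 0 ω ∂P) by field_simp,
    abs_mul, abs_of_pos (inv_pos.2 hn')]

end IsInput

/-- The averages of a convergent bounded function over long intervals converge to its limit. -/
lemma tendsto_integral_average {e : ℝ → ℝ} {M ℓ μ : ℝ} (hm : Measurable e) (hM : ∀ t, |e t| ≤ M)
    (hlim : Tendsto e atTop (𝓝 ℓ)) (hμ : 0 < μ) :
    Tendsto (fun n : ℕ => (n : ℝ)⁻¹ * ∫ t in (0 : ℝ)..n * μ, e t) atTop (𝓝 (μ * ℓ)) := by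
  have hi : ∀ a b, IntervalIntegrable e volume a b := fun a b => by
    refine (intervalIntegrable_const (c := M)).mono_fun hm.aestronglyMeasurable
      (ae_of_all _ fun t => ?_)
    exact (hM t).trans (le_abs_self M)
  -- The integrals over successive windows of length `μ` converge, and the required average is their
  -- Cesàro mean.
  have hstep : Tendsto (fun k : ℕ => ∫ t in (k * μ : ℝ)..(k + 1 : ℕ) * μ, e t) atTop
      (𝓝 (μ * ℓ)) := by
    rw [Metric.tendsto_atTop]
    intro ε hε
    obtain ⟨A, hA⟩ := (Metric.tendsto_atTop.1 hlim) (ε / (2 * μ)) (by positivity)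
    obtain ⟨K, hK⟩ := exists_nat_ge (A / μ)
    refine ⟨K, fun k hk => ?_⟩
    have hle : (k * μ : ℝ) ≤ (k + 1 : ℕ) * μ := by push_cast; nlinarith
    have e1 : (∫ t in (k * μ : ℝ)..(k + 1 : ℕ) * μ, e t) - μ * ℓ
        = ∫ t in (k * μ : ℝ)..(k + 1 : ℕ) * μ, (e t - ℓ) := by
      rw [intervalIntegral.integral_sub (hi _ _) (by simp)]
      simp only [intervalIntegral.integral_const, smul_eq_mul]
      push_cast
      ring
    rw [Real.dist_eq, e1, ← Real.norm_eq_abs]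
    have hb := intervalIntegral.norm_integral_le_of_norm_le_const (a := (k * μ : ℝ))
      (b := (k + 1 : ℕ) * μ) (f := fun t => e t - ℓ) (C := ε / (2 * μ)) fun t ht => by
        rw [Set.uIoc_of_le hle] at ht
        have : A ≤ t := by
          rw [div_le_iff₀ hμ] at hK
          have : (K : ℝ) ≤ k := by exact_mod_cast hk
          nlinarith [ht.1]
        exact (hA t this).le
    refine hb.trans_lt ?_
    push_cast
    rw [show ((k : ℝ) + 1) * μ - k * μ = μ by ring, abs_of_pos hμ]
    field_simp
    linarith
  refine hstep.cesaro.congr fun n => ?_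
  rw [intervalIntegral.sum_integral_adjacent_intervals (a := fun k : ℕ => (k * μ : ℝ))
    fun k _ => hi _ _]
  simp

namespace IsInput

variable [IsProbabilityMeasure P]

lemma integrable_cycle (h : IsInput P U S) (hU : Integrable (U 0) P) {φ : ℝ → ℝ}
    (hφ : Continuous φ) {M : ℝ} (hM : ∀ x, |φ x| ≤ M) (k : ℕ) :
    Integrable (fun ω => ∫ s in (0 : ℝ)..U k ω,
      φ (max (workloadBefore U S k ω + S k ω - s) 0)) P := by
  have hUk : Integrable (U k) P := (h.identDistrib_interarrival k).integrable_iff.2 hU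
  refine (hUk.const_mul M).mono ?_ ?_
  · have hW := h.measurable_workloadBefore k
    have hS := h.measurable_service k
    have hUm := h.measurable_interarrival k
    have e : ∀ᵐ ω ∂P, ∫ s, (Set.Ioc 0 (U k ω)).indicator
        (fun s => φ (max (workloadBefore U S k ω + S k ω - s) 0)) s
        = ∫ s in (0 : ℝ)..U k ω, φ (max (workloadBefore U S k ω + S k ω - s) 0) := by
      filter_upwards [h.nonneg_interarrival k] with ω hω
      rw [intervalIntegral.integral_of_le hω, integral_indicator measurableSet_Ioc]
    refine AEStronglyMeasurable.congr (StronglyMeasurable.aestronglyMeasurable ?_) e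
    refine StronglyMeasurable.integral_prod_right (f := fun (ω : Ω) (s : ℝ) =>
      (Set.Ioc 0 (U k ω)).indicator
        (fun s => φ (max (workloadBefore U S k ω + S k ω - s) 0)) s) ?_
    have hset : MeasurableSet {p : Ω × ℝ | p.2 ∈ Set.Ioc 0 (U k p.1)} :=
      (measurableSet_lt measurable_const measurable_snd).inter
        (measurableSet_le measurable_snd (hUm.comp measurable_fst))
    have hf : Measurable fun p : Ω × ℝ =>
        φ (max (workloadBefore U S k p.1 + S k p.1 - p.2) 0) :=
      hφ.measurable.comp (by fun_prop)
    exact (hf.indicator hset).stronglyMeasurable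
  · filter_upwards [h.nonneg_interarrival k] with ω hω
    have := intervalIntegral.norm_integral_le_of_norm_le_const (a := (0 : ℝ)) (b := U k ω)
      (f := fun s => φ (max (workloadBefore U S k ω + S k ω - s) 0)) (C := M)
      fun s _ => hM _
    rw [sub_zero, abs_of_nonneg hω] at this
    exact this.trans (le_abs_self _)

/-- Cycle averages of a function of the workload converge to the mean cycle length times the limit
of its expectation. -/
lemma tendsto_sum_integral_cycle (h : IsInput P U S) (hU : Integrable (U 0) P)
    (hU0 : 0 < ∫ ω, U 0 ω ∂P) {φ : ℝ → ℝ} (hφ : Continuous φ) {M ℓ : ℝ} (hM : ∀ x, |φ x| ≤ M)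
    (hlim : Tendsto (fun t => ∫ ω, φ (workload U S t ω) ∂P) atTop (𝓝 ℓ)) :
    Tendsto (fun n : ℕ => (n : ℝ)⁻¹ * ∑ k ∈ Finset.range n, ∫ ω, (∫ s in (0 : ℝ)..U k ω,
      φ (max (workloadBefore U S k ω + S k ω - s) 0)) ∂P) atTop
      (𝓝 ((∫ ω, U 0 ω ∂P) * ℓ)) := by
  set μ := ∫ ω, U 0 ω ∂P with hμ
  have hwm : Measurable fun p : ℝ × Ω => φ (workload U S p.1 p.2) :=
    hφ.measurable.comp h.measurable_workload
  have hem : Measurable fun t => ∫ ω, φ (workload U S t ω) ∂P :=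
    hwm.stronglyMeasurable.integral_prod_right.measurable
  have heM : ∀ t, |∫ ω, φ (workload U S t ω) ∂P| ≤ M := fun t => by
    have := norm_integral_le_of_norm_le_const (μ := P) (C := M)
      (f := fun ω => φ (workload U S t ω)) (ae_of_all _ fun y => hM _)
    simpa using this
  have hM0 : 0 ≤ M := (abs_nonneg _).trans (hM 0)
  have haverage := tendsto_integral_average hem heM hlim hU0
  have hcyc := h.integrable_cycle hU hφ hM
  -- The cycles fill `[0, T_n]`, the time average uses `[0, n μ]`; the integrals differ by at most
  -- `M |T_n - n μ|`, whose mean is `o(n)`.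
  have hdiff : ∀ n : ℕ, |(∑ k ∈ Finset.range n, ∫ ω, (∫ s in (0 : ℝ)..U k ω,
      φ (max (workloadBefore U S k ω + S k ω - s) 0)) ∂P)
      - ∫ t in (0 : ℝ)..n * μ, ∫ ω, φ (workload U S t ω) ∂P|
      ≤ M * ∫ ω, |arrivalTime U n ω - n * μ| ∂P := by
    intro n
    have hTi : Integrable (arrivalTime U n) P :=
      integrable_finsetSum _ fun k _ => (h.identDistrib_interarrival k).integrable_iff.2 hU
    have hnμ : 0 ≤ n * μ := by positivity
    have hprod : Integrable (fun p : ℝ × Ω => φ (workload U S p.1 p.2))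
        ((volume.restrict (Set.Ioc 0 (n * μ))).prod P) :=
      Integrable.of_bound hwm.aestronglyMeasurable M (ae_of_all _ fun p => hM _)
    have hswap : ∫ t in (0 : ℝ)..n * μ, ∫ ω, φ (workload U S t ω) ∂P
        = ∫ ω, (∫ t in (0 : ℝ)..n * μ, φ (workload U S t ω)) ∂P := by
      simp_rw [intervalIntegral.integral_of_le hnμ]
      exact integral_integral_swap hprod
    have hi2 : Integrable (fun ω => ∫ t in (0 : ℝ)..n * μ, φ (workload U S t ω)) P := by
      simp_rw [intervalIntegral.integral_of_le hnμ]
      exact hprod.integral_prod_right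
    have hi1 : Integrable (fun ω => ∑ k ∈ Finset.range n, ∫ s in (0 : ℝ)..U k ω,
      φ (max (workloadBefore U S k ω + S k ω - s) 0)) P := integrable_finsetSum _ fun k _ => hcyc k
    rw [hswap, ← integral_finsetSum _ fun k _ => hcyc k, ← integral_sub hi1 hi2,
      ← integral_const_mul M]
    have hbi : Integrable (fun ω => M * |arrivalTime U n ω - n * μ|) P :=
      (hTi.sub (integrable_const _)).abs.const_mul M
    refine norm_integral_le_of_norm_le (f := fun ω => (∑ k ∈ Finset.range n,
      ∫ s in (0 : ℝ)..U k ω, φ (max (workloadBefore U S k ω + S k ω - s) 0))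
      - ∫ t in (0 : ℝ)..n * μ, φ (workload U S t ω)) hbi ?_
    filter_upwards [ae_all_iff.2 h.nonneg_interarrival] with ω hω
    have hint : ∀ a b, IntervalIntegrable (fun t => φ (workload U S t ω)) volume a b := fun a b => by
      refine (intervalIntegrable_const (c := M)).mono_fun
        (hwm.comp measurable_prodMk_right).aestronglyMeasurable (ae_of_all _ fun t => ?_)
      exact (hM _).trans (le_abs_self M)
    rw [← (integral_workload_eq_sum hω hφ n).2,
      intervalIntegral.integral_interval_sub_left (hint _ _) (hint _ _)]
    exact intervalIntegral.norm_integral_le_of_norm_le_const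
      (f := fun t => φ (workload U S t ω)) fun t _ => hM _
  have hzero : Tendsto (fun n : ℕ => (n : ℝ)⁻¹ * ((∑ k ∈ Finset.range n,
      ∫ ω, (∫ s in (0 : ℝ)..U k ω, φ (max (workloadBefore U S k ω + S k ω - s) 0)) ∂P)
      - ∫ t in (0 : ℝ)..n * μ, ∫ ω, φ (workload U S t ω) ∂P)) atTop (𝓝 0) := by
    have hb := (h.tendsto_integral_abs_arrivalTime_sub hU).const_mul M
    rw [mul_zero] at hb
    refine squeeze_zero_norm (fun n => ?_) hb
    rw [norm_mul, Real.norm_eq_abs, Real.norm_eq_abs, abs_of_nonneg (by positivity)]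
    calc _ ≤ (n : ℝ)⁻¹ * (M * ∫ ω, |arrivalTime U n ω - n * μ| ∂P) :=
          mul_le_mul_of_nonneg_left (hdiff n) (by positivity)
      _ = _ := by ring
  have := haverage.add hzero
  rw [add_zero] at this
  refine this.congr fun n => ?_
  ring

end IsInput

end GG1

end

/-! ### Comparison with the diffusion generator -/

noncomputable section

namespace GG1

variable {Ω : Type*} [MeasurableSpace Ω] {P : Measure Ω} {U S : ℕ → Ω → ℝ}

namespace IsInput

variable [IsProbabilityMeasure P]

section Generator

variable {F G D : ℝ → ℝ} {L C K : ℝ}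

lemma abs_le_mul_abs_of_deriv_bounded (hF : ∀ x, HasDerivAt F (G x) x) (hF0 : F 0 = 0)
    (hK : ∀ x, |G x| ≤ K) (x : ℝ) : |F x| ≤ K * |x| :=
  abs_le_mul_abs_of_hasDerivAt hF0 hF fun y _ => hK y

lemma integrable_comp_workloadBefore (h : IsInput P U S) (hU : MemLp (U 0) 2 P)
    (hS : MemLp (S 0) 2 P) (hF : Continuous F) (hFK : ∀ x, |F x| ≤ K * |x|) (k : ℕ) :
    Integrable (fun ω => F (workloadBefore U S k ω)) P := by
  have hW := (h.memLp_workloadBefore hU hS k).integrable (by norm_num)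
  refine (hW.abs.const_mul K).mono
    (hF.measurable.comp (h.measurable_workloadBefore k)).aestronglyMeasurable
    (ae_of_all _ fun ω => ?_)
  exact (hFK _).trans (le_abs_self _)

lemma integrable_abs_pow_three (hU3 : MemLp (U 0) 3 P) (hS3 : MemLp (S 0) 3 P) (ρ : ℝ) :
    Integrable (fun ω => |S 0 ω - ρ * U 0 ω| ^ 3) P :=
  (hS3.sub (hU3.const_mul ρ)).integrable_norm_pow (by norm_num)

/-- The mean increment of `F` over a cycle is close to the mean integral of the diffusion
generator `κ F'' - (1 - ρ) F'` along the workload. -/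
lemma abs_integral_cycle_generator_le (h : IsInput P U S) (hU3 : MemLp (U 0) 3 P)
    (hS3 : MemLp (S 0) 3 P) {ρ κ : ℝ} (hρ0 : 0 ≤ ρ) (hρ1 : ρ ≤ 1) (hκ0 : 0 ≤ κ)
    (hρ : ∫ ω, S 0 ω ∂P = ρ * ∫ ω, U 0 ω ∂P)
    (hκ : (∫ ω, (S 0 ω - ρ * U 0 ω) ^ 2 ∂P) / 2 = κ * ∫ ω, U 0 ω ∂P)
    (hF : ∀ x, HasDerivAt F (G x) x) (hG : ∀ x, HasDerivAt G (D x) x) (hF0 : F 0 = 0)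
    (hG0 : G 0 = 0) (hL0 : 0 ≤ L) (hC0 : 0 ≤ C)
    (hL : ∀ x y, |G x - G y| ≤ L * |x - y|) (hC : ∀ x y, |D x - D y| ≤ C * |x - y|)
    (hGK : ∀ x, |G x| ≤ K) (hDK : ∀ x, |D x| ≤ K) (k : ℕ) :
    |∫ ω, F (workloadBefore U S (k + 1) ω) ∂P - ∫ ω, F (workloadBefore U S k ω) ∂P
      - ∫ ω, (∫ s in (0 : ℝ)..U k ω, (κ * D (max (workloadBefore U S k ω + S k ω - s) 0)
        - (1 - ρ) * G (max (workloadBefore U S k ω + S k ω - s) 0))) ∂P|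
      ≤ ((1 - ρ) * ρ * L * ((∫ ω, U 0 ω ^ 2 ∂P) / 2)
        + C * ∫ ω, |S 0 ω - ρ * U 0 ω| ^ 3 ∂P
        + κ * (C * ((∫ ω, S 0 ω ∂P) * (∫ ω, U 0 ω ∂P) + (∫ ω, U 0 ω ^ 2 ∂P) / 2)))
        + ρ * L / 2 * ∫ ω, idleTime U S k ω ^ 2 ∂P := by
  have hU2 : MemLp (U 0) 2 P := hU3.mono_exponent (by norm_num)
  have hS2 : MemLp (S 0) 2 P := hS3.mono_exponent (by norm_num)
  have hU1 : Integrable (U 0) P := hU2.integrable (by norm_num)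
  have hS1 : Integrable (S 0) P := hS2.integrable (by norm_num)
  have hFc : Continuous F := continuous_iff_continuousAt.2 fun x => (hF x).continuousAt
  have hGc : Continuous G := continuous_iff_continuousAt.2 fun x => (hG x).continuousAt
  have hDc : Continuous D := by
    refine (LipschitzWith.of_dist_le_mul (K := ⟨C, hC0⟩) fun x y => ?_).continuous
    exact hC x y
  have hFK := abs_le_mul_abs_of_deriv_bounded hF hF0 hGK
  have hpast := measurable_past_workloadBefore U S k
  have hWm := h.measurable_workloadBefore k
  have bdd : ∀ {f : ℝ → ℝ}, Continuous f → (∀ x, |f x| ≤ K) →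
      Integrable (fun ω => f (workloadBefore U S k ω)) P := fun hf hb =>
    Integrable.of_bound (hf.measurable.comp hWm).aestronglyMeasurable K (ae_of_all _ fun ω => hb _)
  -- integrability of the individual terms
  have iF1 := h.integrable_comp_workloadBefore hU2 hS2 hFc hFK (k + 1)
  have iF0 := h.integrable_comp_workloadBefore hU2 hS2 hFc hFK k
  have iφ := h.integrable_cycle hU1 (φ := fun x => κ * D x - (1 - ρ) * G x) (by fun_prop)
    (M := κ * K + (1 - ρ) * K) (fun x => by
      refine (abs_sub _ _).trans ?_
      rw [abs_mul, abs_mul, abs_of_nonneg hκ0, abs_of_nonneg (sub_nonneg.2 hρ1)]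
      have := hGK x
      have := hDK x
      have := sub_nonneg.2 hρ1
      gcongr) k
  have mx : Measurable (fun p : ℝ × ℝ => p.2 - ρ * p.1) := by fun_prop
  have my : Measurable (fun p : ℝ × ℝ => (p.2 - ρ * p.1) ^ 2 / 2 - κ * p.1) := by fun_prop
  have ix : Integrable (fun ω => S 0 ω - ρ * U 0 ω) P := hS1.sub (hU1.const_mul ρ)
  have isq : Integrable (fun ω => (S 0 ω - ρ * U 0 ω) ^ 2) P :=
    (hS2.sub (hU2.const_mul ρ)).integrable_sq
  have iy : Integrable (fun ω => (S 0 ω - ρ * U 0 ω) ^ 2 / 2 - κ * U 0 ω) P :=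
    (isq.div_const 2).sub (hU1.const_mul κ)
  have iGx : Integrable (fun ω => G (workloadBefore U S k ω) * (S k ω - ρ * U k ω)) P :=
    h.integrable_past_mul (hGc.measurable.comp hpast) (bdd hGc hGK) mx ix
  have iDy : Integrable (fun ω => D (workloadBefore U S k ω)
      * ((S k ω - ρ * U k ω) ^ 2 / 2 - κ * U k ω)) P :=
    h.integrable_past_mul (hDc.measurable.comp hpast) (bdd hDc hDK) my iy
  -- The first-order Taylor term vanishes since `S - ρ U` is centred and independent of the past;
  -- `eDy` holds because `κ` matches half the second moment of this step to the mean cycle length.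
  have eGx : ∫ ω, G (workloadBefore U S k ω) * (S k ω - ρ * U k ω) ∂P = 0 := by
    have := h.integral_past_mul (hGc.measurable.comp hpast) mx
    simp only [Function.comp_apply] at this
    rw [this, integral_sub hS1 (hU1.const_mul ρ), integral_const_mul, hρ, sub_self, mul_zero]
  have eDy : ∫ ω, D (workloadBefore U S k ω)
      * ((S k ω - ρ * U k ω) ^ 2 / 2 - κ * U k ω) ∂P = 0 := by
    have := h.integral_past_mul (hDc.measurable.comp hpast) my
    simp only [Function.comp_apply] at this
    rw [this, integral_sub (isq.div_const 2) (hU1.const_mul κ), integral_const_mul, integral_div,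
      hκ, sub_self, mul_zero]
  have mU2 : Measurable (fun p : ℝ × ℝ => p.1 ^ 2) := by fun_prop
  have mX3 : Measurable (fun p : ℝ × ℝ => |p.2 - ρ * p.1| ^ 3) := by fun_prop
  have mSU : Measurable (fun p : ℝ × ℝ => p.2 * p.1) := by fun_prop
  have iU2 := h.integrable_pair k mU2 hU2.integrable_sq
  have eU2 := h.integral_pair k mU2
  have iX3 := h.integrable_pair k mX3 (integrable_abs_pow_three hU3 hS3 ρ)
  have eX3 := h.integral_pair k mX3
  have iSU := h.integrable_pair k mSU
    ((h.indepFun_interarrival_service 0).symm.integrable_mul hS1 hU1)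
  have eSU := h.integral_pair k mSU
  simp only at iU2 eU2 iX3 eX3 iSU eSU
  have eSU0 : ∫ ω, S 0 ω * U 0 ω ∂P = (∫ ω, S 0 ω ∂P) * ∫ ω, U 0 ω ∂P :=
    (h.indepFun_interarrival_service 0).symm.integral_fun_mul_eq_mul_integral
      hS1.aestronglyMeasurable hU1.aestronglyMeasurable
  have iI2 := (h.memLp_idleTime hU2 hS2 k).integrable_sq
  -- the pathwise bound
  set B : Ω → ℝ := fun ω => ((1 - ρ) * ρ * L * (U k ω ^ 2 / 2) + C * |S k ω - ρ * U k ω| ^ 3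
    + κ * (C * (S k ω * U k ω + U k ω ^ 2 / 2))) + ρ * L / 2 * idleTime U S k ω ^ 2 with hB
  have j1 : Integrable (fun ω => (1 - ρ) * ρ * L * (U k ω ^ 2 / 2)) P :=
    (iU2.div_const 2).const_mul _
  have j2 : Integrable (fun ω => C * |S k ω - ρ * U k ω| ^ 3) P := iX3.const_mul _
  have j3 : Integrable (fun ω => S k ω * U k ω + U k ω ^ 2 / 2) P := iSU.add (iU2.div_const 2)
  have j4 : Integrable (fun ω => κ * (C * (S k ω * U k ω + U k ω ^ 2 / 2))) P :=
    (j3.const_mul C).const_mul κ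
  have j5 : Integrable (fun ω => ρ * L / 2 * idleTime U S k ω ^ 2) P := iI2.const_mul _
  have j6 : Integrable (fun ω => (1 - ρ) * ρ * L * (U k ω ^ 2 / 2)
      + C * |S k ω - ρ * U k ω| ^ 3) P := j1.add j2
  have j7 : Integrable (fun ω => (1 - ρ) * ρ * L * (U k ω ^ 2 / 2)
      + C * |S k ω - ρ * U k ω| ^ 3 + κ * (C * (S k ω * U k ω + U k ω ^ 2 / 2))) P := j6.add j4
  have iB : Integrable B P := j7.add j5
  have eB : ∫ ω, B ω ∂P = ((1 - ρ) * ρ * L * ((∫ ω, U 0 ω ^ 2 ∂P) / 2)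
        + C * ∫ ω, |S 0 ω - ρ * U 0 ω| ^ 3 ∂P
        + κ * (C * ((∫ ω, S 0 ω ∂P) * (∫ ω, U 0 ω ∂P) + (∫ ω, U 0 ω ^ 2 ∂P) / 2)))
        + ρ * L / 2 * ∫ ω, idleTime U S k ω ^ 2 ∂P := by
    rw [integral_add j7 j5, integral_add j6 j4, integral_add j1 j2, integral_const_mul,
      integral_const_mul, integral_const_mul, integral_const_mul, integral_const_mul,
      integral_add iSU (iU2.div_const 2), integral_div, eU2, eX3, eSU, eSU0]
  have hpath : ∀ᵐ ω ∂P, ‖F (workloadBefore U S (k + 1) ω) - F (workloadBefore U S k ω)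
      - (∫ s in (0 : ℝ)..U k ω, (κ * D (max (workloadBefore U S k ω + S k ω - s) 0)
        - (1 - ρ) * G (max (workloadBefore U S k ω + S k ω - s) 0)))
      - G (workloadBefore U S k ω) * (S k ω - ρ * U k ω)
      - D (workloadBefore U S k ω) * ((S k ω - ρ * U k ω) ^ 2 / 2 - κ * U k ω)‖ ≤ B ω := by
    filter_upwards [h.nonneg_interarrival k, h.nonneg_service k] with ω hu hs
    have hw := workloadBefore_nonneg U S k ω
    -- The three errors: the drift over the cycle started at `W + S`, the Taylor remainder of the
    -- step `S - ρ U`, and the replacement of `κ D(W) U` by the integral of `κ D` along the cycle.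
    have p1 := abs_cycle_drift_le hF hL hL0 hG0 hρ0 hρ1 (v := workloadBefore U S k ω + S k ω)
      (by linarith) hu
    have p2 := abs_taylor_two_le hF hG hC hC0 (workloadBefore U S k ω) (S k ω - ρ * U k ω)
    have p3 := abs_cycle_integral_sub_le hC hC0 hw hs hu
    have p3' := mul_le_mul_of_nonneg_left p3 hκ0
    rw [← abs_of_nonneg hκ0, ← abs_mul, abs_of_nonneg hκ0] at p3'
    have cG : Continuous fun s => G (max (workloadBefore U S k ω + S k ω - s) 0) := by fun_prop
    have cD : Continuous fun s => D (max (workloadBefore U S k ω + S k ω - s) 0) := by fun_prop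
    rw [intervalIntegral.integral_sub ((cD.const_mul κ).intervalIntegrable _ _)
      ((cG.const_mul (1 - ρ)).intervalIntegrable _ _), intervalIntegral.integral_const_mul,
      intervalIntegral.integral_const_mul, Real.norm_eq_abs]
    rw [show workloadBefore U S (k + 1) ω = max (workloadBefore U S k ω + S k ω - U k ω) 0 from rfl]
    rw [show workloadBefore U S k ω + (S k ω - ρ * U k ω)
      = workloadBefore U S k ω + S k ω - ρ * U k ω by ring] at p2
    simp only [hB, idleTime]
    rw [abs_le] at p1 p2 p3' ⊢
    constructor <;> linarith [p1.1, p1.2, p2.1, p2.2, p3'.1, p3'.2]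
  have hfin := norm_integral_le_of_norm_le iB hpath
  have k1 : Integrable (fun ω => F (workloadBefore U S (k + 1) ω) - F (workloadBefore U S k ω)) P :=
    iF1.sub iF0
  have k2 : Integrable (fun ω => F (workloadBefore U S (k + 1) ω) - F (workloadBefore U S k ω)
      - (∫ s in (0 : ℝ)..U k ω, (κ * D (max (workloadBefore U S k ω + S k ω - s) 0)
        - (1 - ρ) * G (max (workloadBefore U S k ω + S k ω - s) 0)))) P := k1.sub iφ
  have k3 : Integrable (fun ω => F (workloadBefore U S (k + 1) ω) - F (workloadBefore U S k ω)
      - (∫ s in (0 : ℝ)..U k ω, (κ * D (max (workloadBefore U S k ω + S k ω - s) 0)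
        - (1 - ρ) * G (max (workloadBefore U S k ω + S k ω - s) 0)))
      - G (workloadBefore U S k ω) * (S k ω - ρ * U k ω)) P := k2.sub iGx
  rw [eB, integral_sub k3 iDy, integral_sub k2 iGx, integral_sub k1 iφ, integral_sub iF1 iF0,
    eGx, eDy, sub_zero, sub_zero] at hfin
  exact hfin

/-- The limiting expectation of the diffusion generator is small. -/
lemma abs_limit_generator_le (h : IsInput P U S) (hU3 : MemLp (U 0) 3 P)
    (hS3 : MemLp (S 0) 3 P) (hdrift : ∫ ω, S 0 ω ∂P < ∫ ω, U 0 ω ∂P)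
    (hU0 : 0 < ∫ ω, U 0 ω ∂P)
    {ρ κ : ℝ} (hρ0 : 0 ≤ ρ) (hρ1 : ρ ≤ 1) (hκ0 : 0 ≤ κ)
    (hρ : ∫ ω, S 0 ω ∂P = ρ * ∫ ω, U 0 ω ∂P)
    (hκ : (∫ ω, (S 0 ω - ρ * U 0 ω) ^ 2 ∂P) / 2 = κ * ∫ ω, U 0 ω ∂P)
    (hF : ∀ x, HasDerivAt F (G x) x) (hG : ∀ x, HasDerivAt G (D x) x) (hF0 : F 0 = 0)
    (hG0 : G 0 = 0) (hL0 : 0 ≤ L) (hC0 : 0 ≤ C)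
    (hL : ∀ x y, |G x - G y| ≤ L * |x - y|) (hC : ∀ x y, |D x - D y| ≤ C * |x - y|)
    (hGK : ∀ x, |G x| ≤ K) (hDK : ∀ x, |D x| ≤ K) {ℓ : ℝ}
    (hlim : Tendsto (fun t => ∫ ω, (κ * D (workload U S t ω) - (1 - ρ) * G (workload U S t ω)) ∂P)
      atTop (𝓝 ℓ)) :
    (∫ ω, U 0 ω ∂P) * |ℓ| ≤ ((1 - ρ) * ρ * L * ((∫ ω, U 0 ω ^ 2 ∂P) / 2)
        + C * ∫ ω, |S 0 ω - ρ * U 0 ω| ^ 3 ∂P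
        + κ * (C * ((∫ ω, S 0 ω ∂P) * (∫ ω, U 0 ω ∂P) + (∫ ω, U 0 ω ^ 2 ∂P) / 2)))
        + ρ * L / 2 * ((∫ ω, idlePeriod U S ω ^ 2 ∂P) *
        ((∫ ω, U 0 ω ∂P - ∫ ω, S 0 ω ∂P) / ∫ ω, idlePeriod U S ω ∂P)) := by
  have hU2 : MemLp (U 0) 2 P := hU3.mono_exponent (by norm_num)
  have hS2 : MemLp (S 0) 2 P := hS3.mono_exponent (by norm_num)
  have hU1 : Integrable (U 0) P := hU2.integrable (by norm_num)
  have hFc : Continuous F := continuous_iff_continuousAt.2 fun x => (hF x).continuousAt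
  have hGc : Continuous G := continuous_iff_continuousAt.2 fun x => (hG x).continuousAt
  have hDc : Continuous D := by
    refine (LipschitzWith.of_dist_le_mul (K := ⟨C, hC0⟩) fun x y => ?_).continuous
    exact hC x y
  have hFK := abs_le_mul_abs_of_deriv_bounded hF hF0 hGK
  set B := (1 - ρ) * ρ * L * ((∫ ω, U 0 ω ^ 2 ∂P) / 2)
        + C * ∫ ω, |S 0 ω - ρ * U 0 ω| ^ 3 ∂P
        + κ * (C * ((∫ ω, S 0 ω ∂P) * (∫ ω, U 0 ω ∂P) + (∫ ω, U 0 ω ^ 2 ∂P) / 2)) with hB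
  set Φ : ℕ → ℝ := fun k => ∫ ω, (∫ s in (0 : ℝ)..U k ω,
    (κ * D (max (workloadBefore U S k ω + S k ω - s) 0)
        - (1 - ρ) * G (max (workloadBefore U S k ω + S k ω - s) 0))) ∂P with hΦ
  have hcyc : Tendsto (fun n : ℕ => (n : ℝ)⁻¹ * ∑ k ∈ Finset.range n, Φ k) atTop
      (𝓝 ((∫ ω, U 0 ω ∂P) * ℓ)) := by
    refine h.tendsto_sum_integral_cycle hU1 hU0 (φ := fun x => κ * D x - (1 - ρ) * G x)
      (by fun_prop) (M := κ * K + (1 - ρ) * K) (fun x => ?_) hlim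
    refine (abs_sub _ _).trans ?_
    rw [abs_mul, abs_mul, abs_of_nonneg hκ0, abs_of_nonneg (sub_nonneg.2 hρ1)]
    have := hGK x
    have := hDK x
    have := sub_nonneg.2 hρ1
    gcongr
  obtain ⟨b, hb, hblim⟩ := h.exists_tendsto_sum_sq_idleTime_le hU2 hS2 hdrift
  have hW := (h.tendsto_integral_workloadBefore_div hU2 hS2 hdrift.le).const_mul K
  have hup := ((hblim.const_mul (ρ * L / 2)).const_add B).add hW
  rw [mul_zero, add_zero] at hup
  have habs := hcyc.abs
  rw [abs_mul, abs_of_pos hU0] at habs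
  refine le_of_tendsto_of_tendsto habs hup ?_
  filter_upwards [eventually_gt_atTop 0] with n hn
  have hn' : (0 : ℝ) < n := by exact_mod_cast hn
  have hstep := fun k => h.abs_integral_cycle_generator_le hU3 hS3 hρ0 hρ1 hκ0 hρ hκ hF hG hF0 hG0
    hL0 hC0 hL hC hGK hDK k
  have hsum : |∑ k ∈ Finset.range n, (∫ ω, F (workloadBefore U S (k + 1) ω) ∂P
      - ∫ ω, F (workloadBefore U S k ω) ∂P - Φ k)|
      ≤ ∑ k ∈ Finset.range n, (B + ρ * L / 2 * ∫ ω, idleTime U S k ω ^ 2 ∂P) :=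
    (Finset.abs_sum_le_sum_abs _ _).trans (Finset.sum_le_sum fun k _ => hstep k)
  -- The increments of `𝔼 F(W_k)` telescope to `𝔼 F(W_n)`, of order at most `𝔼 W_n` because `F`
  -- grows linearly.
  rw [Finset.sum_sub_distrib, Finset.sum_range_sub
    (fun k => ∫ ω, F (workloadBefore U S k ω) ∂P), Finset.sum_add_distrib, Finset.sum_const,
    Finset.card_range, nsmul_eq_mul, ← Finset.mul_sum] at hsum
  have hW0 : ∫ ω, F (workloadBefore U S 0 ω) ∂P = 0 := by simp [workloadBefore, hF0]
  have hWn : |∫ ω, F (workloadBefore U S n ω) ∂P| ≤ K * ∫ ω, workloadBefore U S n ω ∂P := by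
    rw [← integral_const_mul K]
    refine norm_integral_le_of_norm_le (f := fun ω => F (workloadBefore U S n ω))
      (((h.memLp_workloadBefore hU2 hS2 n).integrable (by norm_num)).const_mul K)
      (ae_of_all _ fun ω => ?_)
    have := hFK (workloadBefore U S n ω)
    rwa [abs_of_nonneg (workloadBefore_nonneg U S n ω)] at this
  rw [hW0, sub_zero] at hsum
  have hmain : |∑ k ∈ Finset.range n, Φ k| ≤ K * ∫ ω, workloadBefore U S n ω ∂P
      + (n * B + ρ * L / 2 * ∑ k ∈ Finset.range n, ∫ ω, idleTime U S k ω ^ 2 ∂P) := by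
    rw [abs_le] at hsum hWn ⊢
    constructor <;> linarith [hsum.1, hsum.2, hWn.1, hWn.2]
  rw [abs_mul, abs_of_pos (inv_pos.2 hn')]
  calc (n : ℝ)⁻¹ * |∑ k ∈ Finset.range n, Φ k|
      ≤ (n : ℝ)⁻¹ * (K * ∫ ω, workloadBefore U S n ω ∂P
      + (n * B + ρ * L / 2 * ∑ k ∈ Finset.range n, ∫ ω, idleTime U S k ω ^ 2 ∂P)) := by gcongr
    _ = B + ρ * L / 2 * ((n : ℝ)⁻¹ * ∑ k ∈ Finset.range n, ∫ ω, idleTime U S k ω ^ 2 ∂P)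
        + K * ((n : ℝ)⁻¹ * ∫ ω, workloadBefore U S n ω ∂P) := by
        field_simp
        ring
    _ ≤ _ := by
        have := hb n
        have : 0 ≤ ρ * L / 2 := by positivity
        gcongr

end Generator

end IsInput

end GG1

end

/-! ### The bound for bounded test functions -/

noncomputable section

namespace GG1

variable {Ω : Type*} [MeasurableSpace Ω] {P : Measure Ω} {U S : ℕ → Ω → ℝ}

namespace IsInput

variable [IsProbabilityMeasure P]

lemma integral_interarrival_pos (h : IsInput P U S) (hU : Integrable (U 0) P)
    (hnl : Nonlattice P (U 0)) : 0 < ∫ ω, U 0 ω ∂P := by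
  refine lt_of_le_of_ne (integral_nonneg_of_ae (h.nonneg_interarrival 0)) fun h0 => ?_
  have := (integral_eq_zero_iff_of_nonneg_ae (h.nonneg_interarrival 0) hU).1 h0.symm
  exact hnl 1 one_pos (this.mono fun ω hω => ⟨0, by simpa using hω⟩)

/-- If the second moment were zero, `S = ρ U` almost surely; being also independent of `U`, it would
force `U` to be constant, hence lattice. Concretely, two evaluations of `𝔼 (S U)` give `𝔼 U² = (𝔼
U)²`. -/
lemma integral_sq_sub_pos (h : IsInput P U S) (hU : MemLp (U 0) 2 P) (hS : MemLp (S 0) 2 P)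
    (hnl : Nonlattice P (U 0)) {ρ : ℝ} (hρ0 : 0 < ρ)
    (hρ : ∫ ω, S 0 ω ∂P = ρ * ∫ ω, U 0 ω ∂P) : 0 < ∫ ω, (S 0 ω - ρ * U 0 ω) ^ 2 ∂P := by
  have hU1 : Integrable (U 0) P := hU.integrable (by norm_num)
  have hS1 : Integrable (S 0) P := hS.integrable (by norm_num)
  set μ := ∫ ω, U 0 ω ∂P with hμ
  have hμ0 : 0 < μ := h.integral_interarrival_pos hU1 hnl
  refine lt_of_le_of_ne (integral_nonneg fun ω => sq_nonneg _) fun h0 => ?_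
  have hae := (integral_eq_zero_iff_of_nonneg (fun ω => sq_nonneg (S 0 ω - ρ * U 0 ω))
    (hS.sub (hU.const_mul ρ)).integrable_sq).1 h0.symm
  have hSU : ∫ ω, S 0 ω * U 0 ω ∂P = (∫ ω, S 0 ω ∂P) * ∫ ω, U 0 ω ∂P :=
    (h.indepFun_interarrival_service 0).symm.integral_fun_mul_eq_mul_integral
      hS1.aestronglyMeasurable hU1.aestronglyMeasurable
  have hSU' : ∫ ω, S 0 ω * U 0 ω ∂P = ρ * ∫ ω, U 0 ω ^ 2 ∂P := by
    rw [← integral_const_mul ρ]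
    refine integral_congr_ae (hae.mono fun ω hω => ?_)
    have : S 0 ω - ρ * U 0 ω = 0 := by simpa using hω
    beta_reduce
    rw [sub_eq_zero.1 this]
    ring
  have hsq : ∫ ω, U 0 ω ^ 2 ∂P = μ ^ 2 := by
    rw [hSU', hρ] at hSU
    have := mul_left_cancel₀ hρ0.ne' (hSU.trans (mul_assoc _ _ _))
    rw [this, sq]
  have hvar : ∫ ω, (U 0 ω - μ) ^ 2 ∂P = 0 := by
    have e : ∀ ω, (U 0 ω - μ) ^ 2 = U 0 ω ^ 2 - (2 * μ * U 0 ω - μ ^ 2) := fun ω => by ring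
    simp_rw [e]
    have i1 : Integrable (fun ω => 2 * μ * U 0 ω) P := hU1.const_mul _
    have i2 : Integrable (fun ω => 2 * μ * U 0 ω - μ ^ 2) P := i1.sub (integrable_const _)
    rw [integral_sub hU.integrable_sq i2, integral_sub i1 (integrable_const _),
      integral_const_mul, hsq]
    simp only [integral_const, probReal_univ, smul_eq_mul, one_mul, ← hμ]
    ring
  have hae2 := (integral_eq_zero_iff_of_nonneg (fun ω => sq_nonneg (U 0 ω - μ))
    (hU.sub (memLp_const μ)).integrable_sq).1 hvar
  refine hnl μ hμ0 (hae2.mono fun ω hω => ⟨1, ?_⟩)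
  have : U 0 ω - μ = 0 := by simpa using hω
  rw [sub_eq_zero.1 this]
  simp

end IsInput

/-- The upper bound of the exponential approximation. -/
def errorBound (P : Measure Ω) (U S : ℕ → Ω → ℝ) (ρ : ℝ) : ℝ :=
  (1 - ρ) *
    ((2 + ρ) * ((∫ ω, U 0 ω ^ 2 ∂P) / (2 * ∫ ω, U 0 ω ∂P))
      + ρ * ((∫ ω, idlePeriod U S ω ^ 2 ∂P) / (2 * ∫ ω, idlePeriod U S ω ∂P))
      + 2 * (∫ ω, S 0 ω ∂P)
      + 4 * ((∫ ω, |S 0 ω - ρ * U 0 ω| ^ 3 ∂P) / ∫ ω, (S 0 ω - ρ * U 0 ω) ^ 2 ∂P))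

lemma IsSteadyState.tendsto_integral [IsProbabilityMeasure P] {Ω' : Type*} [MeasurableSpace Ω']
    {P' : Measure Ω'} [IsProbabilityMeasure P'] {X : Ω' → ℝ} (hX : IsSteadyState P U S P' X)
    {φ : ℝ → ℝ} (hφ : Continuous φ) {M : ℝ} (hM : ∀ x, |φ x| ≤ M) :
    Tendsto (fun t => ∫ ω, φ (scaledWorkload P U S t ω) ∂P) atTop (𝓝 (∫ ω, φ (X ω) ∂P')) := by
  have key := (ProbabilityMeasure.tendsto_iff_forall_integral_tendsto.1 hX.tendsto)
    (BoundedContinuousFunction.ofNormedAddCommGroup φ hφ M hM)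
  simp only [ProbabilityMeasure.coe_mk, BoundedContinuousFunction.coe_ofNormedAddCommGroup] at key
  rw [integral_map hX.aemeasurable_limit hφ.aestronglyMeasurable] at key
  refine key.congr fun t => ?_
  rw [integral_map (hX.forall_aemeasurable t) hφ.aestronglyMeasurable]

/-- The exponential approximation for bounded test functions. -/
lemma abs_integral_sub_le_of_bounded [IsProbabilityMeasure P] (hUS : IsInput P U S)
    (hU3 : MemLp (U 0) 3 P) (hS3 : MemLp (S 0) 3 P)
    (hnl : Nonlattice P (U 0)) (hS : 0 < ∫ ω, S 0 ω ∂P)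
    (hρ : utilization P U S < 1)
    {Ω' : Type*} [MeasurableSpace Ω'] (P' : Measure Ω') [IsProbabilityMeasure P']
    {X : Ω' → ℝ} (hX : IsSteadyState P U S P' X) {h : ℝ → ℝ} (hh : LipschitzWith 1 h) {M : ℝ}
    (hM : ∀ x, |h x| ≤ M) :
    |(∫ ω, h (X ω) ∂P') - ∫ y, h y ∂(expMeasure (2 / (arrivalRate P U *
        ∫ ω, (S 0 ω - utilization P U S * U 0 ω) ^ 2 ∂P)))|
      ≤ errorBound P U S (utilization P U S) := by
  have hU2 : MemLp (U 0) 2 P := hU3.mono_exponent (by norm_num)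
  have hS2 : MemLp (S 0) 2 P := hS3.mono_exponent (by norm_num)
  have hU1 : Integrable (U 0) P := hU2.integrable (by norm_num)
  have hμ0 := hUS.integral_interarrival_pos hU1 hnl
  have hρS : ∫ ω, S 0 ω ∂P = utilization P U S * ∫ ω, U 0 ω ∂P := by
    rw [utilization, arrivalRate]; field_simp
  have hρ0 : 0 < utilization P U S := by
    rw [utilization, arrivalRate]; positivity
  have hm2 := hUS.integral_sq_sub_pos hU2 hS2 hnl hρ0 hρS
  have hsc : ∀ t ω, scaledWorkload P U S t ω = (1 - utilization P U S) * workload U S t ω :=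
    fun _ _ => rfl
  rw [errorBound]
  rw [arrivalRate]
  set ρ := utilization P U S with hρdef
  set μ := ∫ ω, U 0 ω ∂P with hμ
  set m := ∫ ω, (S 0 ω - ρ * U 0 ω) ^ 2 ∂P with hm
  set δ := 1 - ρ with hδ
  have hδ0 : 0 < δ := by rw [hδ]; linarith
  set r := 2 / (1 / μ * m) with hr
  have hr0 : 0 < r := by rw [hr]; positivity
  have hr' : r = 2 * μ / m := by rw [hr]; field_simp
  have hprob := isProbabilityMeasure_expMeasure hr0
  have hM0 : 0 ≤ M := (abs_nonneg _).trans (hM 0)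
  set E := ∫ y, h y ∂(expMeasure r) with hE
  have hEM : |E| ≤ M := by simpa using abs_integral_expMeasure_le hr0 hM 0
  set q := steinSolution r h with hq
  have hqd := hasDerivAt_steinSolution hr0 hh.continuous hM
  have hqL := abs_steinSolution_sub_le hr0 hh hM
  have hqM := abs_steinSolution_le hr0 hM
  have hqc : Continuous q := continuous_iff_continuousAt.2 fun x => (hqd x).continuousAt
  -- The Stein solution in unscaled workload units: `G` has Lipschitz constant `δ`, and `D`,
  -- containing both `q` and `h` after a further factor `δ r`, has constant `2 r δ²`.
  set G : ℝ → ℝ := fun v => q (δ * v) with hG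
  set D : ℝ → ℝ := fun v => δ * r * (q (δ * v) + h (δ * v) - E) with hD
  set F : ℝ → ℝ := fun v => ∫ x in (0 : ℝ)..v, G x with hF
  have hGc : Continuous G := hqc.comp (by fun_prop)
  have hFd : ∀ x, HasDerivAt F (G x) x := fun x => (hGc.integral_hasStrictDerivAt 0 x).hasDerivAt
  have hGd : ∀ x, HasDerivAt G (D x) x := fun x => by
    have := (hqd (δ * x)).comp x ((hasDerivAt_id x).const_mul δ)
    exact this.congr_deriv (by simp only [hD]; ring)
  have hdh : ∀ x y, |h x - h y| ≤ |x - y| := fun x y => by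
    simpa [Real.dist_eq] using hh.dist_le_mul x y
  have hδabs : ∀ x y, |δ * x - δ * y| = δ * |x - y| := fun x y => by
    rw [← mul_sub, abs_mul, abs_of_pos hδ0]
  have hGL : ∀ x y, |G x - G y| ≤ δ * |x - y| := fun x y => by
    have := hqL (δ * x) (δ * y)
    rwa [hδabs] at this
  have hDL : ∀ x y, |D x - D y| ≤ 2 * r * δ ^ 2 * |x - y| := fun x y => by
    have h1 := hqL (δ * x) (δ * y)
    have h2 := hdh (δ * x) (δ * y)
    rw [hδabs] at h1 h2
    have e : D x - D y = δ * r * ((q (δ * x) - q (δ * y)) + (h (δ * x) - h (δ * y))) := by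
      simp only [hD]; ring
    rw [e, abs_mul, abs_of_pos (mul_pos hδ0 hr0)]
    calc _ ≤ δ * r * (δ * |x - y| + δ * |x - y|) := by
          gcongr
          exact (abs_add_le _ _).trans (add_le_add h1 h2)
      _ = _ := by ring
  set K := max (2 * M) (δ * r * (4 * M)) with hK
  have hGK : ∀ x, |G x| ≤ K := fun x => (hqM _).trans (le_max_left _ _)
  have hDK : ∀ x, |D x| ≤ K := fun x => by
    refine le_trans ?_ (le_max_right _ _)
    simp only [hD]
    rw [abs_mul, abs_of_pos (mul_pos hδ0 hr0)]
    gcongr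
    have h1 := hqM (δ * x)
    have h2 := hM (δ * x)
    rw [abs_le] at h1 h2 hEM ⊢
    constructor <;> linarith [h1.1, h1.2, h2.1, h2.2, hEM.1, hEM.2]
  have hgen : ∀ v, r⁻¹ * D v - (1 - ρ) * G v = δ * (h (δ * v) - E) := fun v => by
    simp only [hD, hG]
    field_simp
    ring
  have hlim : Tendsto (fun t => ∫ ω, (r⁻¹ * D (workload U S t ω) - (1 - ρ) * G (workload U S t ω)) ∂P)
      atTop (𝓝 (δ * ((∫ ω, h (X ω) ∂P') - E))) := by
    have hMX : ∀ x, |δ * (h x - E)| ≤ δ * (M + M) := fun x => by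
      rw [abs_mul, abs_of_pos hδ0]
      gcongr
      exact (abs_sub _ _).trans (add_le_add (hM x) hEM)
    have hc := hh.continuous
    have := hX.tendsto_integral (φ := fun x => δ * (h x - E)) (by fun_prop) hMX
    have hXi : Integrable (fun ω => h (X ω)) P' :=
      Integrable.of_bound (hc.measurable.comp_aemeasurable hX.aemeasurable_limit).aestronglyMeasurable
        M (ae_of_all _ fun ω => hM _)
    rw [integral_const_mul, integral_sub hXi (integrable_const _)] at this
    simp only [integral_const, probReal_univ, smul_eq_mul, one_mul] at this
    refine this.congr fun t => integral_congr_ae (ae_of_all _ fun ω => ?_)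
    simp only [hsc, hgen]
  have hdrift : ∫ ω, S 0 ω ∂P < μ := by rw [hρS]; nlinarith
  have key := hUS.abs_limit_generator_le hU3 hS3 hdrift hμ0 hρ0.le hρ.le (inv_nonneg.2 hr0.le) hρS
    (by rw [hr']; field_simp; rfl) hFd hGd (by simp [hF])
    (by simp [hG, hq, steinSolution_zero]) hδ0.le (by positivity) hGL hDL hGK hDK hlim
  have hJ := hUS.integral_idlePeriod_pos hU2 hS2 hdrift
  rw [abs_mul, abs_of_pos hδ0] at key
  have hfac : 0 < μ * δ := by positivity
  -- With `L = δ`, `C = 2 r δ²`, `κ = r⁻¹` and `r = 2 μ / m`, the right side of `key` is exactly `μ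
  -- δ` times the claimed bound.
  refine le_of_mul_le_mul_left (le_trans (le_of_eq (by ring)) (key.trans (le_of_eq ?_))) hfac
  rw [show μ - ∫ ω, S 0 ω ∂P = μ * δ by rw [hρS, hδ]; ring, ← hδ, hr']
  simp only [← hμ]
  field_simp
  ring

end GG1

end

/-! ### Removal of the boundedness assumption on the test function -/

theorem theorem1 {Ω : Type*} [MeasurableSpace Ω] (P : Measure Ω) [IsProbabilityMeasure P]
    (U S : ℕ → Ω → ℝ) (hUS : GG1.IsInput P U S)
    (hU3 : MemLp (U 0) 3 P) (hS3 : MemLp (S 0) 3 P)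
    (hnl : GG1.Nonlattice P (U 0)) (hS : 0 < ∫ ω, S 0 ω ∂P)
    (ρ : ℝ) (hρ_def : ρ = GG1.utilization P U S) (hρ : ρ < 1)
    {Ω' : Type*} [MeasurableSpace Ω'] (P' : Measure Ω') [IsProbabilityMeasure P']
    (X : Ω' → ℝ) (hX : GG1.IsSteadyState P U S P' X) :
    Integrable X P' ∧
    Integrable (fun ω => GG1.idlePeriod U S ω ^ 2) P ∧
    0 < ∫ ω, GG1.idlePeriod U S ω ∂P ∧
    ∀ h : ℝ → ℝ, LipschitzWith 1 h →
      |(∫ ω, h (X ω) ∂P')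
        - ∫ y, h y ∂(expMeasure (2 / (GG1.arrivalRate P U * ∫ ω, (S 0 ω - ρ * U 0 ω) ^ 2 ∂P)))|
      ≤ (1 - ρ) *
        ((2 + ρ) * ((∫ ω, U 0 ω ^ 2 ∂P) / (2 * ∫ ω, U 0 ω ∂P))
          + ρ * ((∫ ω, GG1.idlePeriod U S ω ^ 2 ∂P) / (2 * ∫ ω, GG1.idlePeriod U S ω ∂P))
          + 2 * (∫ ω, S 0 ω ∂P)
          + 4 * ((∫ ω, |S 0 ω - ρ * U 0 ω| ^ 3 ∂P) / ∫ ω, (S 0 ω - ρ * U 0 ω) ^ 2 ∂P)) := by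
  subst hρ_def
  have hU2 : MemLp (U 0) 2 P := hU3.mono_exponent (by norm_num)
  have hS2 : MemLp (S 0) 2 P := hS3.mono_exponent (by norm_num)
  have hμ0 := hUS.integral_interarrival_pos (hU2.integrable (by norm_num)) hnl
  have hρS : ∫ ω, S 0 ω ∂P = GG1.utilization P U S * ∫ ω, U 0 ω ∂P := by
    rw [GG1.utilization, GG1.arrivalRate]; field_simp
  have hρ0 : 0 < GG1.utilization P U S := by
    rw [GG1.utilization, GG1.arrivalRate]; positivity
  have hdrift : ∫ ω, S 0 ω ∂P < ∫ ω, U 0 ω ∂P := by rw [hρS]; nlinarith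
  have hm2 := hUS.integral_sq_sub_pos hU2 hS2 hnl hρ0 hρS
  have hbdd := fun (h : ℝ → ℝ) (hh : LipschitzWith 1 h) (M : ℝ) (hM : ∀ x, |h x| ≤ M) =>
    GG1.abs_integral_sub_le_of_bounded hUS hU3 hS3 hnl hS hρ P' hX hh hM
  set r := 2 / (GG1.arrivalRate P U * ∫ ω, (S 0 ω - GG1.utilization P U S * U 0 ω) ^ 2 ∂P) with hr
  have hr0 : 0 < r := by rw [hr, GG1.arrivalRate]; positivity
  have hprob := isProbabilityMeasure_expMeasure hr0
  have hY := GG1.integrable_id_expMeasure hr0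
  have hXm := hX.aemeasurable_limit
  have hXi : Integrable X P' := by
    refine ⟨hXm.aestronglyMeasurable, ?_⟩
    -- Truncated absolute values are admissible bounded test functions, and the error bound does not
    -- depend on `n`; monotone convergence then bounds `𝔼 |X|`.
    have hclip : ∀ n : ℕ, LipschitzWith 1 fun x : ℝ => min |x| n := fun n => by
      simpa using (lipschitzWith_one_norm (E := ℝ)).min_const n
    have hn : ∀ (n : ℕ) (x : ℝ), |min |x| n| ≤ n := fun n x => by
      rw [abs_of_nonneg (le_min (abs_nonneg x) n.cast_nonneg)]
      exact min_le_right _ _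
    have hle : ∀ n : ℕ, ∫ ω, min |X ω| n ∂P'
        ≤ ∫ y, |y| ∂(expMeasure r) + GG1.errorBound P U S (GG1.utilization P U S) := by
      intro n
      have h1 := (abs_le.1 (hbdd _ (hclip n) n (hn n))).2
      have h2 : ∫ y : ℝ, min |y| n ∂(expMeasure r) ≤ ∫ y, |y| ∂(expMeasure r) := by
        refine integral_mono (Integrable.of_bound (by fun_prop) n (ae_of_all _ (hn n))) hY.abs
          fun y => min_le_left _ _
      linarith
    have hsup : ∫⁻ ω, ENNReal.ofReal |X ω| ∂P'
        ≤ ENNReal.ofReal (∫ y, |y| ∂(expMeasure r)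
          + GG1.errorBound P U S (GG1.utilization P U S)) := by
      have hmono : ∫⁻ ω, ENNReal.ofReal |X ω| ∂P'
          = ⨆ n : ℕ, ∫⁻ ω, ENNReal.ofReal (min |X ω| n) ∂P' := by
        rw [← lintegral_iSup' (fun n => by fun_prop) (ae_of_all _ fun ω n m hnm => by
          have : (n : ℝ) ≤ m := by exact_mod_cast hnm
          beta_reduce
          gcongr)]
        refine lintegral_congr fun ω => le_antisymm ?_ (iSup_le fun n =>
          ENNReal.ofReal_le_ofReal (min_le_left _ _))
        obtain ⟨n, hn⟩ := exists_nat_ge |X ω|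
        exact le_iSup_of_le n (by rw [min_eq_left hn])
      rw [hmono]
      refine iSup_le fun n => ?_
      rw [← ofReal_integral_eq_lintegral_ofReal
        (Integrable.of_bound (by fun_prop) n (ae_of_all _ fun ω => hn n (X ω)))
        (ae_of_all _ fun ω => le_min (abs_nonneg _) n.cast_nonneg)]
      exact ENNReal.ofReal_le_ofReal (hle n)
    rw [hasFiniteIntegral_iff_norm]
    exact hsup.trans_lt ENNReal.ofReal_lt_top
  refine ⟨hXi, (hUS.hasSum_integral_idlePeriod hU2 hS2 hdrift two_ne_zero le_rfl).1,
    hUS.integral_idlePeriod_pos hU2 hS2 hdrift, fun h hh => ?_⟩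
  have hdom : ∀ x, |h x| ≤ |h 0| + |x| := fun x => by
    have h1 : |h x - h 0| ≤ |x - 0| := by simpa [Real.dist_eq] using hh.dist_le_mul x 0
    have h2 := abs_add_le (h 0) (h x - h 0)
    rw [add_sub_cancel] at h2
    rw [sub_zero] at h1
    linarith
  -- Two-sided truncation keeps the Lipschitz constant and is dominated by `|h 0| + |x|`, integrable
  -- for both laws, so the bound passes to the limit.
  have hclip : ∀ n : ℕ, LipschitzWith 1 fun x : ℝ => max (min (h x) n) (-n) := fun n =>
    (hh.min_const n).max_const (-n)
  have hn : ∀ (n : ℕ) (x : ℝ), |max (min (h x) n) (-n)| ≤ n := fun n x => by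
    have : (0 : ℝ) ≤ n := n.cast_nonneg
    exact abs_le.2 ⟨le_max_right _ _, max_le (min_le_right _ _) (by linarith)⟩
  have hclip_le : ∀ (n : ℕ) (x : ℝ), |max (min (h x) n) (-n)| ≤ |h x| := fun n x => by
    have : (0 : ℝ) ≤ n := n.cast_nonneg
    rcases le_total 0 (h x) with h0 | h0
    · rw [abs_of_nonneg h0, abs_of_nonneg (le_max_of_le_left (le_min h0 this))]
      exact max_le (min_le_left _ _) (by linarith)
    · rw [abs_of_nonpos h0, abs_of_nonpos (max_le ((min_le_left _ _).trans h0) (by linarith)),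
        min_eq_left (by linarith)]
      exact neg_le_neg (le_max_left _ _)
  have hptw : ∀ x, Tendsto (fun n : ℕ => max (min (h x) n) (-n)) atTop (𝓝 (h x)) := fun x => by
    refine tendsto_const_nhds.congr' ?_
    obtain ⟨N, hN⟩ := exists_nat_ge |h x|
    filter_upwards [eventually_ge_atTop N] with n hNn
    have : (N : ℝ) ≤ n := by exact_mod_cast hNn
    have := abs_le.1 (hN.trans this)
    rw [min_eq_left this.2, max_eq_left this.1]
  have hlimX : Tendsto (fun n : ℕ => ∫ ω, max (min (h (X ω)) n) (-n) ∂P') atTop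
      (𝓝 (∫ ω, h (X ω) ∂P')) :=
    tendsto_integral_of_dominated_convergence (fun ω => |h 0| + |X ω|)
      (fun n => ((hclip n).continuous.measurable.comp_aemeasurable hXm).aestronglyMeasurable)
      ((integrable_const _).add hXi.abs)
      (fun n => ae_of_all _ fun ω => (hclip_le n _).trans (hdom _))
      (ae_of_all _ fun ω => hptw _)
  have hlimY : Tendsto (fun n : ℕ => ∫ y, max (min (h y) n) (-n) ∂(expMeasure r)) atTop
      (𝓝 (∫ y, h y ∂(expMeasure r))) :=
    tendsto_integral_of_dominated_convergence (fun y => |h 0| + |y|)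
      (fun n => (hclip n).continuous.aestronglyMeasurable)
      ((integrable_const _).add hY.abs)
      (fun n => ae_of_all _ fun y => (hclip_le n _).trans (hdom _))
      (ae_of_all _ fun y => hptw _)
  exact le_of_tendsto' (hlimX.sub hlimY).abs fun n => hbdd _ (hclip n) n (hn n)
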